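/- Let $k$ be a field, let $n,m\ge 0$, let $S=k[x_1,\dots,x_m,z_0,\dots,z_n]$ with its standard grading, and let $X=\mathbb P^n=\operatorname{Proj} k[z_0,\dots,z_n]$, the linear subspace $x_1=\dots=x_m=0$ of $\mathbb P^{n+m}=\operatorname{Proj} S$. An $m$-dimensional Young diagram is a finite set $T\subset\mathbb N^m$ (of boxes) such that $B\in T$ and $B'\le B$ coordinatewise imply $B'\in T$. The weight of a box $B=(r_1,\dots,r_m)$ is $w_B=r_1+\dots+r_m$, and its monomial is $x^B=x_1^{r_1}\cdots x_m^{r_m}$. Let $J\subset S$ be the ideal generated by the monomials $x^B$ with $B\in\mathbb N^m\setminus T$, and let $Y=\operatorname{Proj}(S/J)\subset\mathbb P^{n+m}$ be the corresponding multiple scheme (its support is $X$ if $T\neq\emptyset$). Let $\pi:Y\to X$ be the restriction to $Y$ of the linear projection $[x:z]\mapsto[z]$, which makes $\mathcal O_Y$ (that is, $\pi_*\mathcal O_Y$) a sheaf of $\mathcal O_X$-algebras. Then there is an isomorphism of $\mathcal O_X$-modules $$\varphi:\ \bigoplus_{B\in T}\mathcal O_X(-w_B)\ \xrightarrow{\ \sim\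 }\ \mathcal O_Y .$$ Moreover, give $\bigoplus_{B\in T}\mathcal O_X(-w_B)$ the structure of a sheaf of $\mathcal O_X$-algebras in which the summand of $B$ is written $\mathcal O_X(-w_B)\,e_B$ with $e_B$ standing for the monomial $x^B$: for local sections $s$ of $\mathcal O_X(-w_A)$ and $t$ of $\mathcal O_X(-w_B)$ put $(s\,e_A)(t\,e_B)=st\,e_{A+B}$ if $A+B\in T$ and $(s\,e_A)(t\,e_B)=0$ otherwise, the structure map from $\mathcal O_X$ being $r\mapsto r\,e_0$ (and zero if $T=\emptyset$). Then $\varphi$ can be chosen to be an isomorphism of $\mathcal O_X$-algebras for this structure, sending $s\,e_B$ to $s\,x^B$; that is, a local section $s=a/b$ of $\mathcal O_X(-w_B)$, with $a,b\in k[z_0,\dots,z_n]$ homogeneous and $\deg b=\deg a+w_B$, in the summand of $B$ is sent to the section $a\,x^B/b$ of $\mathcal O_Y$. -/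

import Mathlib

open AlgebraicGeometry CategoryTheory CategoryTheory.Limits TopologicalSpace Opposite Graded

universe u

noncomputable section

namespace MonomialScheme

/-! ### The grading of the quotient of a graded ring by a homogeneous ideal -/

section Quotient
variable {k A : Type u} [CommRing k] [CommRing A] [Algebra k A] (𝒜 : ℕ → Submodule k A)
  [GradedAlgebra 𝒜] (I : HomogeneousIdeal 𝒜)

/-- The degree `i` part of `A / I` is the image of the degree `i` part of `A`. -/
def quotientGrading (i : ℕ) : Submodule k (A ⧸ I.toIdeal) :=
  (𝒜 i).map (Ideal.Quotient.mkₐ k I.toIdeal).toLinearMap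

instance : SetLike.GradedMonoid (quotientGrading 𝒜 I) where
  one_mem := ⟨1, SetLike.one_mem_graded 𝒜, map_one (Ideal.Quotient.mk I.toIdeal)⟩
  mul_mem := by
    rintro i j _ _ ⟨a, ha, rfl⟩ ⟨b, hb, rfl⟩
    exact ⟨a * b, SetLike.mul_mem_graded ha hb, map_mul (Ideal.Quotient.mk I.toIdeal) _ _⟩

/-- The quotient map in degree `i`. -/
def quotientComponent (i : ℕ) : 𝒜 i →ₗ[k] quotientGrading 𝒜 I i :=
  (Ideal.Quotient.mkₐ k I.toIdeal).toLinearMap.restrict fun a ha => ⟨a, ha, rfl⟩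

/-- Decompose an element of `A` into homogeneous components, then reduce each of them mod `I`. -/
def decomposeThenQuotient : A →+ DirectSum ℕ fun i => quotientGrading 𝒜 I i :=
  (DirectSum.lmap (quotientComponent 𝒜 I)).toAddMonoidHom.comp
    (DirectSum.decomposeAddEquiv 𝒜).toAddMonoidHom

/-- The decomposition of an element of `A / I` into homogeneous components. -/
def quotientDecompose : (A ⧸ I.toIdeal) →+ DirectSum ℕ fun i => quotientGrading 𝒜 I i :=
  QuotientAddGroup.lift I.toIdeal.toAddSubgroup (decomposeThenQuotient 𝒜 I) (by
    intro a ha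
    refine DFinsupp.ext fun i => Subtype.ext ?_
    exact Ideal.Quotient.eq_zero_iff_mem.mpr (I.isHomogeneous i ha))

lemma quotientDecompose_mk {i : ℕ} (a : 𝒜 i) :
    quotientDecompose 𝒜 I (Ideal.Quotient.mk I.toIdeal a) =
      DirectSum.of (fun i => quotientGrading 𝒜 I i) i (quotientComponent 𝒜 I i a) := by
  change DirectSum.lmap (quotientComponent 𝒜 I) (DirectSum.decompose 𝒜 (a : A)) = _
  rw [DirectSum.decompose_coe]
  exact DirectSum.lmap_lof _ _ _

instance : GradedAlgebra (quotientGrading 𝒜 I) where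
  decompose' := quotientDecompose 𝒜 I
  left_inv := by
    intro x
    obtain ⟨a, rfl⟩ := Ideal.Quotient.mk_surjective x
    induction a using DirectSum.Decomposition.inductionOn 𝒜 with
    | zero => simp
    | homogeneous a =>
      rw [quotientDecompose_mk, DirectSum.coeAddMonoidHom_of]; rfl
    | add a b ha hb => rw [map_add, map_add, map_add, ha, hb]
  right_inv := by
    intro x
    induction x using DirectSum.induction_on with
    | zero => simp
    | of i x =>
      obtain ⟨_, a, ha, rfl⟩ := x
      rw [DirectSum.coeAddMonoidHom_of]
      exact quotientDecompose_mk 𝒜 I ⟨a, ha⟩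
    | add a b ha hb => rw [map_add, map_add, ha, hb]

end Quotient

/-- An `m`-dimensional Young diagram: a finite set of boxes, each box being named by its innermost
corner `(r₁, …, r_m) ∈ ℕ^m`, such that with a box all the boxes below it (in all directions) are
also in the diagram. -/
structure YoungDiag (m : ℕ) where
  /-- the set of boxes -/
  boxes : Finset (Fin m →₀ ℕ)
  /-- below a box there are only boxes of the diagram -/
  isLowerSet : IsLowerSet (boxes : Set (Fin m →₀ ℕ))

/-- The weight of a box is the sum of its coordinates. -/
def weight {m : ℕ} (B : Fin m →₀ ℕ) : ℕ := ∑ i, B i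

namespace YoungDiag

variable {m : ℕ} (T : YoungDiag m) 

section BoxSum
variable (R : Type u) [CommRing R]
/-- `⨁_B R e_B`, the sum over the boxes `B` of the diagram, as functions `T → R`. It carries the
multiplication of monomials: `e_A e_B = e_{A+B}` if `A + B` is a box of the diagram, and
`e_A e_B = 0` otherwise. -/
def BoxSum : Type u := T.boxes → R

instance : AddCommGroup (T.BoxSum R) := inferInstanceAs (AddCommGroup (T.boxes → R))

variable {R} {T}

lemma antidiagonal_fst_le {C : Fin m →₀ ℕ} {p : (Fin m →₀ ℕ) × (Fin m →₀ ℕ)}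
    (h : p ∈ Finset.HasAntidiagonal.antidiagonal C) : p.1 ≤ C := by
  rw [← Finset.HasAntidiagonal.mem_antidiagonal.mp h]; exact le_self_add

lemma antidiagonal_snd_le {C : Fin m →₀ ℕ} {p : (Fin m →₀ ℕ) × (Fin m →₀ ℕ)}
    (h : p ∈ Finset.HasAntidiagonal.antidiagonal C) : p.2 ≤ C := by
  rw [← Finset.HasAntidiagonal.mem_antidiagonal.mp h]; exact le_add_self

/-- The coefficient of `e_C` in a product is `∑_{A + B = C} s_A t_B`. -/
instance : Mul (T.BoxSum R) where
  mul s t := fun C => ∑ p : Finset.HasAntidiagonal.antidiagonal C.1,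
    s ⟨p.1.1, T.isLowerSet (antidiagonal_fst_le p.2) C.2⟩ *
    t ⟨p.1.2, T.isLowerSet (antidiagonal_snd_le p.2) C.2⟩

/-- The unit is `e_0`. -/
instance : One (T.BoxSum R) where
  one := fun C => if C.1 = 0 then 1 else 0

/-- Forget the coefficients of a polynomial at the monomials outside of the diagram. -/
def truncate (p : MvPolynomial (Fin m) R) : T.BoxSum R := fun C => p.coeff C.1

lemma truncate_surjective : Function.Surjective (truncate (T := T) (R := R)) := by
  intro s
  refine ⟨∑ B : T.boxes, MvPolynomial.monomial B.1 (s B), funext fun C => ?_⟩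
  simp only [truncate, MvPolynomial.coeff_sum, MvPolynomial.coeff_monomial]
  rw [Finset.sum_eq_single C]
  · simp
  · intro B _ h
    rw [if_neg fun h' => h (Subtype.ext h')]
  · simp

lemma truncate_mul (p q : MvPolynomial (Fin m) R) :
    truncate (T := T) (p * q) = truncate p * truncate q := by
  funext C
  change MvPolynomial.coeff C.1 (p * q) = _
  rw [MvPolynomial.coeff_mul, ← Finset.sum_coe_sort]
  rfl

lemma truncate_one : truncate (T := T) (1 : MvPolynomial (Fin m) R) = 1 := by
  funext C
  change MvPolynomial.coeff C.1 1 = if C.1 = 0 then 1 else 0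
  rw [MvPolynomial.coeff_one]
  simp only [eq_comm]

lemma truncate_add (p q : MvPolynomial (Fin m) R) :
    truncate (T := T) (p + q) = truncate p + truncate q := rfl

lemma truncate_zero : truncate (T := T) (0 : MvPolynomial (Fin m) R) = 0 := rfl

instance : CommRing (T.BoxSum R) where
  left_distrib a b c := by
    obtain ⟨a, rfl⟩ := truncate_surjective a
    obtain ⟨b, rfl⟩ := truncate_surjective b
    obtain ⟨c, rfl⟩ := truncate_surjective c
    simp only [← truncate_mul, ← truncate_add, mul_add]
  right_distrib a b c := by
    obtain ⟨a, rfl⟩ := truncate_surjective a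
    obtain ⟨b, rfl⟩ := truncate_surjective b
    obtain ⟨c, rfl⟩ := truncate_surjective c
    simp only [← truncate_mul, ← truncate_add, add_mul]
  zero_mul a := by
    obtain ⟨a, rfl⟩ := truncate_surjective a
    simp only [← truncate_zero, ← truncate_mul, zero_mul]
  mul_zero a := by
    obtain ⟨a, rfl⟩ := truncate_surjective a
    simp only [← truncate_zero, ← truncate_mul, mul_zero]
  mul_assoc a b c := by
    obtain ⟨a, rfl⟩ := truncate_surjective a
    obtain ⟨b, rfl⟩ := truncate_surjective b
    obtain ⟨c, rfl⟩ := truncate_surjective c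
    simp only [← truncate_mul, mul_assoc]
  one_mul a := by
    obtain ⟨a, rfl⟩ := truncate_surjective a
    simp only [← truncate_one, ← truncate_mul, one_mul]
  mul_one a := by
    obtain ⟨a, rfl⟩ := truncate_surjective a
    simp only [← truncate_one, ← truncate_mul, mul_one]
  mul_comm a b := by
    obtain ⟨a, rfl⟩ := truncate_surjective a
    obtain ⟨b, rfl⟩ := truncate_surjective b
    simp only [← truncate_mul, mul_comm]
  sub_eq_add_neg := sub_eq_add_neg
  zsmul := fun n a => n • a
  zsmul_zero' := fun a => SubNegMonoid.zsmul_zero' a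
  zsmul_succ' := fun n a => SubNegMonoid.zsmul_succ' n a
  zsmul_neg' := fun n a => SubNegMonoid.zsmul_neg' n a
  neg_add_cancel := neg_add_cancel

variable (T R) in
/-- The structure map `r ↦ r e_0`. -/
def constant : R →+* T.BoxSum R where
  toFun r := fun C => if C.1 = 0 then r else 0
  map_one' := rfl
  map_zero' := funext fun C => ite_self 0
  map_add' r s := funext fun C => by
    change (if C.1 = 0 then r + s else 0) = (if C.1 = 0 then r else 0) + if C.1 = 0 then s else 0
    split_ifs <;> simp
  map_mul' r s := by
    have h : ∀ r : R, (fun C => if C.1 = 0 then r else 0 : T.BoxSum R) =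
        truncate (MvPolynomial.C r) := fun r => funext fun C => by
      change _ = MvPolynomial.coeff C.1 (MvPolynomial.C r)
      rw [MvPolynomial.coeff_C]
      simp only [eq_comm]
    rw [h, h, h, map_mul, truncate_mul]

end BoxSum
end YoungDiag

/-! ### Morphisms between Proj's

`Proj.map` of Mathlib asks that the irrelevant ideal of the target is generated by the image of the
irrelevant ideal of the source. Here it is only assumed that no point of `Proj ℬ` contains this
image, which is all that is needed to have a morphism defined everywhere on `Proj ℬ`. -/

namespace ProjGen

variable {A B σ τ : Type u} [CommRing A] [SetLike σ A] [AddSubgroupClass σ A]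
  [CommRing B] [SetLike τ B] [AddSubgroupClass τ B]
  {𝒜 : ℕ → σ} {ℬ : ℕ → τ} [GradedRing 𝒜] [GradedRing ℬ]
  (f : 𝒜 →+*ᵍ ℬ)
  (hf : ∀ p : ProjectiveSpectrum ℬ, ¬ HomogeneousIdeal.irrelevant 𝒜 ≤ p.asHomogeneousIdeal.comap f)

/-- The morphism on points: a homogeneous prime is sent to its preimage under `f`. -/
def comapFun (p : ProjectiveSpectrum ℬ) : ProjectiveSpectrum 𝒜 where
  asHomogeneousIdeal := p.1.comap f
  isPrime := p.2.comap f
  not_irrelevant_le := hf p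

/-- The morphism on points, as a continuous map. -/
def comap : C(ProjectiveSpectrum ℬ, ProjectiveSpectrum 𝒜) where
  toFun := comapFun f hf
  continuous_toFun := by
    simp_rw [continuous_iff_isClosed, ProjectiveSpectrum.isClosed_iff_zeroLocus, exists_imp, forall_eq_apply_imp_iff]
    exact fun s ↦ ⟨f '' s, by ext; simp [comapFun]⟩

open HomogeneousLocalization ProjectiveSpectrum.StructureSheaf

variable (U : Opens (ProjectiveSpectrum 𝒜)) (V : Opens (ProjectiveSpectrum ℬ))
  (hUV : V.1 ⊆ comap f hf ⁻¹' U.1)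

/-- The homomorphism `𝒜_(f⁻¹ p) → ℬ_(p)`, `a / b ↦ f a / f b`, of homogeneous localizations. -/
def fiberMap (p : ProjectiveSpectrum ℬ) :
    AtPrime 𝒜 (comap f hf p).asHomogeneousIdeal.toIdeal →+*
      AtPrime ℬ p.asHomogeneousIdeal.toIdeal :=
  localRingHom f (comap f hf p).asHomogeneousIdeal.toIdeal p.asHomogeneousIdeal.toIdeal rfl

lemma fiberMap_mk (p : ProjectiveSpectrum ℬ)
    (c : NumDenSameDeg 𝒜 (comap f hf p).asHomogeneousIdeal.toIdeal.primeCompl) :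
    fiberMap f hf p (HomogeneousLocalization.mk c) =
      HomogeneousLocalization.mk ⟨c.deg, ⟨f c.num, f.2 c.num.2⟩, ⟨f c.den, f.2 c.den.2⟩, c.den_mem⟩ :=
  rfl

/-- The map on sections of the structure sheaves, pointwise. -/
def comapSectionsFun
    (s : ∀ x : U, AtPrime 𝒜 x.1.1.1) (y : V) : AtPrime ℬ y.1.1.1 :=
  fiberMap f hf y.1 <| s ⟨comap f hf y.1, hUV y.2⟩

lemma isLocallyFraction_comapSectionsFun
    (s : ∀ x : U, AtPrime 𝒜 x.1.1.1) (hs : (isLocallyFraction 𝒜).pred s) :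
    (isLocallyFraction ℬ).pred (comapSectionsFun f hf U V hUV s) := by
  rintro ⟨p, hpV⟩
  rcases hs ⟨comap f hf p, hUV hpV⟩ with ⟨W, m, iWU, i, a, b, hb, h_frac⟩
  refine ⟨W.comap (comap f hf) ⊓ V, ⟨m, hpV⟩, Opens.infLERight _ _, i,
    f.gradedAddHom i a, f.gradedAddHom i b, fun ⟨q, ⟨hqW, hqV⟩⟩ ↦ hb ⟨_, hqW⟩,
    fun ⟨q, ⟨hqW, hqV⟩⟩ ↦ ?_⟩
  exact (congrArg (fiberMap f hf q) (h_frac ⟨_, hqW⟩)).trans (fiberMap_mk f hf q _)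

/-- The map on sections of the structure sheaves. -/
def comapSections :
    (ProjectiveSpectrum.Proj.structureSheaf 𝒜).1.obj (.op U) →+*
      (ProjectiveSpectrum.Proj.structureSheaf ℬ).1.obj (.op V) where
  toFun s := ⟨comapSectionsFun _ _ _ _ hUV s.1,
      isLocallyFraction_comapSectionsFun _ _ _ _ hUV _ s.2⟩
  map_one' := Subtype.ext (funext fun y => map_one (fiberMap f hf y.1))
  map_zero' := Subtype.ext (funext fun y => map_zero (fiberMap f hf y.1))
  map_add' _ _ := Subtype.ext (funext fun y => map_add (fiberMap f hf y.1) _ _)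
  map_mul' _ _ := Subtype.ext (funext fun y => map_mul (fiberMap f hf y.1) _ _)

/-- The morphism of sheafed spaces. -/
def sheafedSpaceMap :
    Proj.toSheafedSpace ℬ ⟶ Proj.toSheafedSpace 𝒜 where
  hom :=
    { base := TopCat.ofHom <| comap f hf
      c :=
        { app := fun U => (CommRingCat.ofHom <| comapSections f hf U.unop
            (U.unop.comap (comap f hf)) Set.Subset.rfl :)
          naturality := fun _ _ _ => rfl } }

open ProjectiveSpectrum in
theorem stalkIso'_stalkMap (p : ProjectiveSpectrum ℬ)
    (x : (Proj.structureSheaf 𝒜).presheaf.stalk (comap f hf p)) :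
    Proj.stalkIso' ℬ p ((sheafedSpaceMap f hf).hom.stalkMap p x) =
      fiberMap f hf p (Proj.stalkIso' 𝒜 (comap f hf p) x) := by
  obtain ⟨U, hxU, s, rfl⟩ := (Proj.structureSheaf 𝒜).presheaf.exists_germ_eq x
  have h1 := PresheafedSpace.stalkMap_germ_apply (sheafedSpaceMap f hf).hom U p hxU s
  have h2 := Proj.stalkIso'_germ 𝒜 U (comap f hf p) hxU s
  have h3 := Proj.stalkIso'_germ ℬ (U.comap (comap f hf)) p hxU
    (comapSections f hf U (U.comap (comap f hf)) Set.Subset.rfl s)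
  exact ((congrArg (Proj.stalkIso' ℬ p) h1).trans h3).trans (congrArg (fiberMap f hf p) h2.symm)

theorem isUnit_of_fiberMap (p : ProjectiveSpectrum ℬ)
    (x : AtPrime 𝒜 (comap f hf p).asHomogeneousIdeal.toIdeal) (hx : IsUnit (fiberMap f hf p x)) :
    IsUnit x := by
  have h : IsLocalHom (localRingHom f (comap f hf p).asHomogeneousIdeal.toIdeal
      p.asHomogeneousIdeal.toIdeal rfl) :=
    instIsLocalHomAtPrimeRingHomLocalRingHom
  exact h.map_nonunit x hx

open ProjectiveSpectrum in
theorem isLocalHom_stalkMap (p : ProjectiveSpectrum ℬ) :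
    IsLocalHom ((sheafedSpaceMap f hf).hom.stalkMap p).hom := by
  refine ⟨fun x hx => ?_⟩
  have h := hx.map (Proj.stalkIso' ℬ p)
  have h' : IsUnit (fiberMap f hf p (Proj.stalkIso' 𝒜 (comap f hf p) x)) :=
    (stalkIso'_stalkMap f hf p x) ▸ h
  have h2 := (isUnit_of_fiberMap f hf p _ h').map (Proj.stalkIso' 𝒜 (comap f hf p)).symm
  exact (RingEquiv.symm_apply_apply (Proj.stalkIso' 𝒜 (comap f hf p)) x) ▸ h2

/-- The morphism of schemes `Proj ℬ ⟶ Proj 𝒜` given by a homomorphism `f : 𝒜 → ℬ` of graded rings. -/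
def map : Proj ℬ ⟶ Proj 𝒜 where
  __ := (sheafedSpaceMap f hf).hom
  prop p := isLocalHom_stalkMap f hf p

end ProjGen

/-! ### The sheaves `𝒪(d)` on `Proj` -/

section Twist

variable {A σ : Type u} [CommRing A] [SetLike σ A] [AddSubgroupClass σ A] (𝒜 : ℕ → σ) [GradedRing 𝒜]

/-- The localization of the graded ring at a point of `Proj`. All the fibres used below (of the
structure sheaf and of the twists `𝒪(d)`) are subgroups of it. -/
abbrev Loc (x : ProjectiveSpectrum 𝒜) : Type u :=
  Localization.AtPrime x.asHomogeneousIdeal.toIdeal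

/-- The values of a section of the structure sheaf of `Proj`, considered in the localizations of `A`. -/
def stalkValue (U : Opens (ProjectiveSpectrum.top 𝒜)) :
    Γ(Proj 𝒜, U) →+* ∀ x : U, Loc 𝒜 x.1 where
  toFun r x := (r.1 x).val
  map_one' := funext fun _ => HomogeneousLocalization.val_one
  map_zero' := funext fun _ => HomogeneousLocalization.val_zero
  map_add' _ _ := funext fun _ => HomogeneousLocalization.val_add _ _
  map_mul' _ _ := funext fun _ => HomogeneousLocalization.val_mul _ _

/-- The functions that are a fraction `a / b` with `a`, `b` homogeneous and
`deg a = deg b + d`. -/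
def fractionOfDegree (d : ℤ) : TopCat.PrelocalPredicate (X := ProjectiveSpectrum.top 𝒜) (Loc 𝒜) where
  pred {U} s := ∃ (i j : ℕ) (a : 𝒜 i) (b : 𝒜 j), (i : ℤ) = j + d ∧
    ∃ hb : ∀ x : U, b.1 ∉ x.1.asHomogeneousIdeal,
      ∀ x : U, s x = Localization.mk a.1 ⟨b.1, hb x⟩
  res := by
    rintro U V f s ⟨i, j, a, b, h, hb, hs⟩
    exact ⟨i, j, a, b, h, fun x => hb (f x), fun x => hs (f x)⟩

/-- The functions that are locally a fraction of degree `d`. -/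
def locallyFractionOfDegree (d : ℤ) : TopCat.LocalPredicate (X := ProjectiveSpectrum.top 𝒜) (Loc 𝒜) :=
  (fractionOfDegree 𝒜 d).sheafify

lemma mul_notMem (x : ProjectiveSpectrum 𝒜) {a b : A} (ha : a ∉ x.asHomogeneousIdeal)
    (hb : b ∉ x.asHomogeneousIdeal) : a * b ∉ x.asHomogeneousIdeal :=
  x.asHomogeneousIdeal.toIdeal.primeCompl.mul_mem ha hb

lemma lfd_zero (d : ℤ) (U : Opens (ProjectiveSpectrum.top 𝒜)) :
    (locallyFractionOfDegree 𝒜 d).pred (0 : ∀ x : U, Loc 𝒜 x.1) := by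
  intro x
  obtain ⟨N, f, hf, hN, hfx⟩ : ∃ (N : ℕ) (f : A), f ∈ 𝒜 N ∧ 0 ≤ (N : ℤ) + d ∧
      f ∉ x.1.asHomogeneousIdeal := by
    have hx := x.1.not_irrelevant_le
    replace hx : ¬ (HomogeneousIdeal.irrelevant 𝒜).toIdeal ≤ x.1.asHomogeneousIdeal.toIdeal := hx
    rw [HomogeneousIdeal.toIdeal_irrelevant_le] at hx
    push Not at hx
    obtain ⟨i, hi, hx⟩ := hx
    obtain ⟨f, hf, hfx⟩ := SetLike.not_le_iff_exists.mp hx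
    refine ⟨d.natAbs • i, f ^ d.natAbs, SetLike.pow_mem_graded _ hf, ?_, fun h => hfx ?_⟩
    · have : d.natAbs ≤ d.natAbs • i := Nat.le_mul_of_pos_right _ hi
      omega
    · exact x.1.isPrime.mem_of_pow_mem _ h
  refine ⟨U ⊓ ProjectiveSpectrum.basicOpen 𝒜 f, ⟨x.2, hfx⟩, Opens.infLELeft _ _,
    ((N : ℤ) + d).toNat, N, 0, ⟨f, hf⟩, Int.toNat_of_nonneg hN, fun y => y.2.2, fun y => ?_⟩
  exact (Localization.mk_zero _).symm

lemma lfd_one (U : Opens (ProjectiveSpectrum.top 𝒜)) :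
    (locallyFractionOfDegree 𝒜 0).pred (1 : ∀ x : U, Loc 𝒜 x.1) := by
  refine TopCat.PrelocalPredicate.sheafifyOf ⟨0, 0, ⟨1, SetLike.one_mem_graded 𝒜⟩,
    ⟨1, SetLike.one_mem_graded 𝒜⟩, by simp, ?_, ?_⟩
  · exact fun x => (Ideal.ne_top_iff_one _).mp x.1.isPrime.ne_top
  · exact fun x => Localization.mk_one.symm

lemma lfd_add {d : ℤ} {U : Opens (ProjectiveSpectrum.top 𝒜)} {s t : ∀ x : U, Loc 𝒜 x.1}
    (hs : (locallyFractionOfDegree 𝒜 d).pred s) (ht : (locallyFractionOfDegree 𝒜 d).pred t) :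
    (locallyFractionOfDegree 𝒜 d).pred (s + t) := by
  refine TopCat.PrelocalPredicate.sheafify_inductionOn₂' _ _ (fractionOfDegree 𝒜 d)
    (fun a b => a + b) ?_ hs ht
  rintro U V s t ⟨i, j, a, b, h, hb, hs⟩ ⟨i', j', a', b', h', hb', ht⟩
  refine ⟨j + i', j + j', ⟨b.1 * a'.1 + b'.1 * a.1, ?_⟩, ⟨b.1 * b'.1, SetLike.mul_mem_graded b.2 b'.2⟩,
    by push_cast; omega, ?_, ?_⟩
  · refine add_mem (SetLike.mul_mem_graded b.2 a'.2) ?_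
    have : j + i' = j' + i := by omega
    rw [this]
    exact SetLike.mul_mem_graded b'.2 a.2
  · exact fun x => mul_notMem 𝒜 x.1
      (hb ⟨x.1, x.2.1⟩) (hb' ⟨x.1, x.2.2⟩)
  · intro x
    change s ⟨x.1, x.2.1⟩ + t ⟨x.1, x.2.2⟩ = _
    rw [hs, ht, Localization.add_mk]
    rfl

lemma lfd_neg {d : ℤ} {U : Opens (ProjectiveSpectrum.top 𝒜)} {s : ∀ x : U, Loc 𝒜 x.1}
    (hs : (locallyFractionOfDegree 𝒜 d).pred s) :
    (locallyFractionOfDegree 𝒜 d).pred (-s) := by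
  refine TopCat.PrelocalPredicate.sheafify_inductionOn' (fractionOfDegree 𝒜 d)
    (fun a => -a) ?_ hs
  rintro U s ⟨i, j, a, b, h, hb, hs⟩
  refine ⟨i, j, ⟨-a.1, neg_mem a.2⟩, b, h, hb, fun x => ?_⟩
  change -s x = _
  rw [hs, Localization.neg_mk]

lemma lfd_mul {d e : ℤ} {U : Opens (ProjectiveSpectrum.top 𝒜)} {s t : ∀ x : U, Loc 𝒜 x.1}
    (hs : (locallyFractionOfDegree 𝒜 d).pred s) (ht : (locallyFractionOfDegree 𝒜 e).pred t) :
    (locallyFractionOfDegree 𝒜 (d + e)).pred (s * t) := by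
  refine TopCat.PrelocalPredicate.sheafify_inductionOn₂' _ _ (fractionOfDegree 𝒜 (d + e))
    (fun a b => a * b) ?_ hs ht
  rintro U V s t ⟨i, j, a, b, h, hb, hs⟩ ⟨i', j', a', b', h', hb', ht⟩
  refine ⟨i + i', j + j', ⟨a.1 * a'.1, SetLike.mul_mem_graded a.2 a'.2⟩,
    ⟨b.1 * b'.1, SetLike.mul_mem_graded b.2 b'.2⟩, by push_cast; omega, ?_, ?_⟩
  · exact fun x => mul_notMem 𝒜 x.1
      (hb ⟨x.1, x.2.1⟩) (hb' ⟨x.1, x.2.2⟩)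
  · intro x
    change s ⟨x.1, x.2.1⟩ * t ⟨x.1, x.2.2⟩ = _
    rw [hs, ht, Localization.mk_mul]
    rfl

lemma lfd_stalkValue (U : Opens (ProjectiveSpectrum.top 𝒜)) (r : Γ(Proj 𝒜, U)) :
    (locallyFractionOfDegree 𝒜 0).pred (stalkValue 𝒜 U r) := by
  intro x
  obtain ⟨V, hx, i, j, a, b, hb, hr⟩ := r.2 x
  refine ⟨V, hx, i, j, j, a, b, by simp, hb, fun y => ?_⟩
  exact (congrArg HomogeneousLocalization.val (hr y)).trans (HomogeneousLocalization.val_mk _)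

/-- The sections of `𝒪(d)` over `U`. -/
def twistSections (d : ℤ) (U : Opens (ProjectiveSpectrum.top 𝒜)) :
    AddSubgroup (∀ x : U, Loc 𝒜 x.1) where
  carrier := {s | (locallyFractionOfDegree 𝒜 d).pred s}
  zero_mem' := lfd_zero 𝒜 d U
  add_mem' := lfd_add 𝒜
  neg_mem' := lfd_neg 𝒜

/-- Sections of `𝒪` act on sections of `𝒪(d)` by multiplication. -/
instance twistModule (d : ℤ) (U : Opens (ProjectiveSpectrum.top 𝒜)) :
    Module Γ(Proj 𝒜, U) (twistSections 𝒜 d U) where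
  smul r s := ⟨stalkValue 𝒜 U r * s.1, by
    have := lfd_mul 𝒜 (lfd_stalkValue 𝒜 U r) s.2
    rwa [zero_add] at this⟩
  one_smul s := Subtype.ext (by
    change stalkValue 𝒜 U 1 * s.1 = s.1
    rw [map_one, one_mul])
  mul_smul r r' s := Subtype.ext (by
    change stalkValue 𝒜 U (r * r') * s.1 = stalkValue 𝒜 U r * (stalkValue 𝒜 U r' * s.1)
    rw [map_mul, mul_assoc])
  smul_zero r := Subtype.ext (mul_zero (stalkValue 𝒜 U r))
  smul_add r s t := Subtype.ext (mul_add (stalkValue 𝒜 U r) s.1 t.1)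
  add_smul r r' s := Subtype.ext (by
    change stalkValue 𝒜 U (r + r') * s.1 = stalkValue 𝒜 U r * s.1 + stalkValue 𝒜 U r' * s.1
    rw [map_add, add_mul])
  zero_smul s := Subtype.ext (by
    change stalkValue 𝒜 U 0 * s.1 = 0
    rw [map_zero, zero_mul])

/-- Restriction of sections of `𝒪(d)`. -/
def twistRestrict (d : ℤ) {U V : Opens (ProjectiveSpectrum.top 𝒜)} (i : V ⟶ U) :
    twistSections 𝒜 d U →+ twistSections 𝒜 d V where
  toFun s := ⟨fun x => s.1 (i x), (locallyFractionOfDegree 𝒜 d).res i s.1 s.2⟩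
  map_zero' := rfl
  map_add' _ _ := rfl

lemma twistRestrict_smul (d : ℤ) {U V : Opens (ProjectiveSpectrum.top 𝒜)} (i : V ⟶ U)
    (r : Γ(Proj 𝒜, U)) (r' : Γ(Proj 𝒜, V)) (h : (Proj 𝒜).presheaf.map i.op r = r')
    (s : twistSections 𝒜 d U) :
    twistRestrict 𝒜 d i (r • s) = r' • twistRestrict 𝒜 d i s := by
  subst h
  rfl

/-- The (pre)sheaf of abelian groups underlying `𝒪(d)`. -/
def twistPresheaf (d : ℤ) : TopCat.Presheaf Ab.{u} (ProjectiveSpectrum.top 𝒜) where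
  obj U := AddCommGrpCat.of (twistSections 𝒜 d U.unop)
  map i := AddCommGrpCat.ofHom (twistRestrict 𝒜 d i.unop)

lemma twistPresheaf_isSheaf (d : ℤ) : (twistPresheaf 𝒜 d).IsSheaf :=
  (TopCat.Presheaf.isSheaf_iff_isSheaf_comp (forget Ab) _).mpr
    (TopCat.Presheaf.isSheaf_of_iso (NatIso.ofComponents (fun _ => Iso.refl _) (fun _ => rfl))
      (TopCat.subpresheafToTypes.isSheaf (locallyFractionOfDegree 𝒜 d)))

/-- The Serre twist `𝒪(d)` on `Proj 𝒜`, as a sheaf of modules. -/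
def serreTwist (d : ℤ) : (Proj 𝒜).Modules where
  val := @PresheafOfModules.ofPresheaf _ _ (Proj 𝒜).ringCatSheaf.obj (twistPresheaf 𝒜 d)
    (fun U => twistModule 𝒜 d U.unop)
    (by
      intro U V f r s
      exact twistRestrict_smul 𝒜 d f.unop r _ rfl s)
  isSheaf := twistPresheaf_isSheaf 𝒜 d


lemma lfd_sum {ι : Type} (S : Finset ι) {d : ℤ} {U : Opens (ProjectiveSpectrum.top 𝒜)}
    (s : ι → ∀ x : U, Loc 𝒜 x.1) (hs : ∀ i, (locallyFractionOfDegree 𝒜 d).pred (s i)) :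
    (locallyFractionOfDegree 𝒜 d).pred (fun x : U => ∑ i ∈ S, s i x) := by
  have h := AddSubgroup.sum_mem (twistSections 𝒜 d U) (t := S) fun i _ => hs i
  have h' : (∑ i ∈ S, s i) = fun x : U => ∑ i ∈ S, s i x := funext fun x => Finset.sum_apply x S s
  exact h' ▸ h

/-! ### The sheaf of algebras `⨁_B 𝒪(-w_B) e_B` of a Young diagram -/

variable {m : ℕ} (T : YoungDiag m)

/-- Functions whose component at each box `B` is locally a fraction of degree `-w_B`. -/
def boxPredicate : TopCat.LocalPredicate (X := ProjectiveSpectrum.top 𝒜)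
    (fun x => T.BoxSum (Loc 𝒜 x)) where
  pred s := ∀ B : T.boxes,
    (locallyFractionOfDegree 𝒜 (-(weight B.1 : ℤ))).pred (fun x => s x B)
  res i _ hs B := (locallyFractionOfDegree 𝒜 _).res i _ (hs B)
  locality _ hs B := (locallyFractionOfDegree 𝒜 _).locality _ fun x =>
    let ⟨V, hx, i, h⟩ := hs x
    ⟨V, hx, i, h B⟩

lemma boxPredicate_mul {U : Opens (ProjectiveSpectrum.top 𝒜)}
    {s t : ∀ x : U, T.BoxSum (Loc 𝒜 x.1)} (hs : (boxPredicate 𝒜 T).pred s)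
    (ht : (boxPredicate 𝒜 T).pred t) : (boxPredicate 𝒜 T).pred (s * t) := by
  intro C
  refine lfd_sum 𝒜 (Finset.univ : Finset (Finset.HasAntidiagonal.antidiagonal C.1))
    (fun p x => s x ⟨p.1.1, T.isLowerSet (YoungDiag.antidiagonal_fst_le p.2) C.2⟩ *
      t x ⟨p.1.2, T.isLowerSet (YoungDiag.antidiagonal_snd_le p.2) C.2⟩) fun p => ?_
  have hw : -(weight C.1 : ℤ) = -(weight p.1.1 : ℤ) + -(weight p.1.2 : ℤ) := by
    have h1 : weight C.1 = weight p.1.1 + weight p.1.2 := by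
      have h2 := Finset.HasAntidiagonal.mem_antidiagonal.mp p.2
      generalize p.1 = q at h2
      rw [← h2]
      exact Finset.sum_add_distrib
    omega
  rw [hw]
  exact lfd_mul 𝒜
    (s := fun x => s x ⟨p.1.1, T.isLowerSet (YoungDiag.antidiagonal_fst_le p.2) C.2⟩)
    (t := fun x => t x ⟨p.1.2, T.isLowerSet (YoungDiag.antidiagonal_snd_le p.2) C.2⟩)
    (hs ⟨p.1.1, T.isLowerSet (YoungDiag.antidiagonal_fst_le p.2) C.2⟩)
    (ht ⟨p.1.2, T.isLowerSet (YoungDiag.antidiagonal_snd_le p.2) C.2⟩)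

/-- The sections over `U` of `⨁_B 𝒪(-w_B) e_B`: families `(s_B)_B` of sections of `𝒪(-w_B)`, with
the multiplication of monomials `e_A e_B = e_{A+B}` if `A + B` is in the diagram, and `0` otherwise. -/
def boxSections (U : Opens (ProjectiveSpectrum.top 𝒜)) :
    Subring (∀ x : U, T.BoxSum (Loc 𝒜 x.1)) where
  carrier := {s | (boxPredicate 𝒜 T).pred s}
  zero_mem' B := lfd_zero 𝒜 _ U
  add_mem' hs ht B := lfd_add 𝒜 (hs B) (ht B)
  neg_mem' hs B := lfd_neg 𝒜 (hs B)
  one_mem' B := by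
    by_cases hB : B.1 = 0
    · have h : (fun x : U => (1 : T.BoxSum (Loc 𝒜 x.1)) B) = 1 := funext fun x => if_pos hB
      have hw : -(weight B.1 : ℤ) = 0 := by simp [hB, weight]
      exact h ▸ hw ▸ lfd_one 𝒜 U
    · have h : (fun x : U => (1 : T.BoxSum (Loc 𝒜 x.1)) B) = 0 := funext fun x => if_neg hB
      exact h ▸ lfd_zero 𝒜 _ U
  mul_mem' {s t} hs ht := boxPredicate_mul 𝒜 T hs ht

/-- The (pre)sheaf of rings `⨁_B 𝒪(-w_B) e_B`. -/
def boxPresheaf : TopCat.Presheaf CommRingCat.{u} (ProjectiveSpectrum.top 𝒜) where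
  obj U := CommRingCat.of (boxSections 𝒜 T U.unop)
  map {U V} i := CommRingCat.ofHom
    { toFun := fun s => ⟨fun x => s.1 (i.unop x), (boxPredicate 𝒜 T).res i.unop s.1 s.2⟩
      map_zero' := rfl
      map_one' := rfl
      map_mul' := fun _ _ => rfl
      map_add' := fun _ _ => rfl }

lemma boxPresheaf_isSheaf : (boxPresheaf 𝒜 T).IsSheaf :=
  (TopCat.Presheaf.isSheaf_iff_isSheaf_comp (forget CommRingCat) _).mpr
    (TopCat.Presheaf.isSheaf_of_iso (NatIso.ofComponents (fun _ => Iso.refl _) (fun _ => rfl))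
      (TopCat.subpresheafToTypes.isSheaf (boxPredicate 𝒜 T)))

/-- The structure map `r ↦ r e_0` from the structure sheaf. -/
def boxConstant (U : Opens (ProjectiveSpectrum.top 𝒜)) :
    Γ(Proj 𝒜, U) →+* boxSections 𝒜 T U :=
  RingHom.codRestrict
    (RingHom.pi fun x => (YoungDiag.constant T (Loc 𝒜 x.1)).comp
      ((Pi.evalRingHom _ x).comp (stalkValue 𝒜 U))) (boxSections 𝒜 T U) (by
    intro r B
    by_cases hB : B.1 = 0
    · have h : (fun x : U => YoungDiag.constant T (Loc 𝒜 x.1) (stalkValue 𝒜 U r x) B) =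
          stalkValue 𝒜 U r := funext fun x => if_pos hB
      have hw : -(weight B.1 : ℤ) = 0 := by simp [hB, weight]
      exact h ▸ hw ▸ lfd_stalkValue 𝒜 U r
    · have h : (fun x : U => YoungDiag.constant T (Loc 𝒜 x.1) (stalkValue 𝒜 U r x) B) = 0 :=
        funext fun x => if_neg hB
      exact h ▸ lfd_zero 𝒜 _ U)

/-- The sheaf `⨁_B 𝒪(-w_B) e_B` as a sheaf of (commutative) `𝒪`-algebras, that is, a sheaf of
commutative rings under `𝒪`. -/
def boxAlgebra : Under (Proj 𝒜).sheaf :=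
  Under.mk (Y := (⟨boxPresheaf 𝒜 T, boxPresheaf_isSheaf 𝒜 T⟩ :
      TopCat.Sheaf CommRingCat.{u} (ProjectiveSpectrum.top 𝒜)))
    ⟨{ app := fun U => CommRingCat.ofHom (R := Γ(Proj 𝒜, U.unop)) (boxConstant 𝒜 T U.unop)
       naturality := fun _ _ _ => rfl }⟩

/-- The inclusion `s ↦ s e_B` of the summand `𝒪(-w_B)` of `⨁_B 𝒪(-w_B) e_B`. -/
def boxSingle (B : T.boxes) (U : Opens (ProjectiveSpectrum.top 𝒜))
    (s : twistSections 𝒜 (-(weight B.1 : ℤ)) U) : boxSections 𝒜 T U :=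
  ⟨fun x C => if C = B then s.1 x else 0, fun C => by
    by_cases hC : C = B
    · subst hC
      have h : (fun x : U => if C = C then s.1 x else 0) = s.1 := funext fun x => if_pos rfl
      exact (congrArg (locallyFractionOfDegree 𝒜 _).pred h).mpr s.2
    · have h : (fun x : U => if C = B then s.1 x else 0) = 0 := funext fun x => if_neg hC
      exact h ▸ lfd_zero 𝒜 _ U⟩

end Twist

/-- For a morphism `f : Y ⟶ X`, the sheaf `f_* 𝒪_Y` as a sheaf of `𝒪_X`-algebras. -/
def pushforwardAlgebra {X Y : Scheme.{u}} (f : Y ⟶ X) : Under X.sheaf :=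
  Under.mk (Y := (TopCat.Sheaf.pushforward CommRingCat.{u} f.base).obj Y.sheaf) ⟨f.c⟩

/-- For a morphism `f : Y ⟶ X`, the sheaf `f_* 𝒪_Y` as an `𝒪_X`-module. -/
def pushforwardModule {X Y : Scheme.{u}} (f : Y ⟶ X) : X.Modules :=
  (Scheme.Modules.pushforward f).obj (SheafOfModules.unit Y.ringCatSheaf)

section LocalizationMap
variable {A B σ τ : Type u} [CommRing A] [SetLike σ A] [AddSubgroupClass σ A]
  [CommRing B] [SetLike τ B] [AddSubgroupClass τ B]
  {𝒜 : ℕ → σ} {ℬ : ℕ → τ} [GradedRing 𝒜] [GradedRing ℬ]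
  (f : 𝒜 →+*ᵍ ℬ)
  (hf : ∀ p : ProjectiveSpectrum ℬ, ¬ HomogeneousIdeal.irrelevant 𝒜 ≤ p.asHomogeneousIdeal.comap f)

/-- The homomorphism `A_(f⁻¹ p) → B_p`, `a / b ↦ f a / f b`, of (full) localizations. -/
def locMap (p : ProjectiveSpectrum ℬ) : Loc 𝒜 (ProjGen.comap f hf p) →+* Loc ℬ p :=
  Localization.localRingHom _ _ f.toRingHom rfl
end LocalizationMap

/-! ### The multiple structure on projective space defined by a Young diagram -/

section Diagram

variable {m : ℕ} (T : YoungDiag m) (k : Type u) [Field k] (n : ℕ)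

/-- The standard grading of `k[z_0, …, z_n]`. -/
abbrev baseGrading : ℕ → Submodule k (MvPolynomial (Fin (n + 1)) k) :=
  MvPolynomial.homogeneousSubmodule (Fin (n + 1)) k

instance : GradedAlgebra (baseGrading k n) := MvPolynomial.gradedAlgebra

/-- `X = ℙⁿ = Proj k[z_0, …, z_n]`. -/
abbrev projectiveSpace : Scheme.{u} := Proj (baseGrading k n)

/-- The standard grading of `S = k[x_1, …, x_m, z_0, …, z_n]`, the homogeneous coordinate ring of
`ℙ^{n+m}`; in it `X` is the linear subspace `x_1 = ⋯ = x_m = 0`. -/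
abbrev ambientGrading (m : ℕ) : ℕ → Submodule k (MvPolynomial (Fin m ⊕ Fin (n + 1)) k) :=
  MvPolynomial.homogeneousSubmodule (Fin m ⊕ Fin (n + 1)) k

instance : GradedAlgebra (ambientGrading k n m) := MvPolynomial.gradedAlgebra

/-- The monomial `x^B = x_1^{r_1} ⋯ x_m^{r_m}` of the box `B = (r_1, …, r_m)`. -/
def boxMonomial (B : Fin m →₀ ℕ) : MvPolynomial (Fin m ⊕ Fin (n + 1)) k :=
  ∏ i, MvPolynomial.X (Sum.inl i) ^ B i

/-- The monomial ideal `J ⊆ S` of the diagram, generated by all monomials in `x_1, …, x_m` that do not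
correspond to boxes of the diagram. -/
def diagramIdeal : HomogeneousIdeal (ambientGrading k n m) where
  toSubmodule := Ideal.span (boxMonomial k n '' {B | B ∉ T.boxes})
  is_homogeneous' := Ideal.homogeneous_span _ _ (by
    rintro _ ⟨B, _, rfl⟩
    refine ⟨∑ i, B i, (MvPolynomial.mem_homogeneousSubmodule _ _).mpr ?_⟩
    refine MvPolynomial.IsHomogeneous.prod _ _ _ fun i _ => ?_
    simpa using (MvPolynomial.isHomogeneous_X k (Sum.inl i)).pow (B i))

/-- The grading of the homogeneous coordinate ring `S / J`. -/
abbrev diagramGrading : ℕ → Submodule k (MvPolynomial (Fin m ⊕ Fin (n + 1)) k ⧸ (diagramIdeal T k n).toIdeal) :=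
  quotientGrading (ambientGrading k n m) (diagramIdeal T k n)

/-- The multiple scheme `Y` of the diagram: the closed subscheme `Proj (S / J)` of `ℙ^{n+m}` cut out by
the ideal of the diagram. Its underlying reduced scheme is `X` if the diagram is not empty. -/
abbrev multipleScheme : Scheme.{u} := Proj (diagramGrading T k n)

/-- The homomorphism `k[z_0, …, z_n] → S → S / J`, `z_j ↦ z_j`. -/
def coordinateMap : baseGrading k n →+*ᵍ diagramGrading T k n where
  toRingHom := (Ideal.Quotient.mk (diagramIdeal T k n).toIdeal).comp
    (MvPolynomial.rename Sum.inr).toRingHom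
  map_mem := by
    intro i p hp
    exact ⟨MvPolynomial.rename Sum.inr p, MvPolynomial.IsHomogeneous.rename_isHomogeneous hp, rfl⟩

lemma coordinateMap_irrelevant (p : ProjectiveSpectrum (diagramGrading T k n)) :
    ¬ HomogeneousIdeal.irrelevant (baseGrading k n) ≤
      p.asHomogeneousIdeal.comap (coordinateMap T k n) := by
  intro h
  refine p.not_irrelevant_le ?_
  have key : ∀ v : Fin m ⊕ Fin (n + 1),
      Ideal.Quotient.mk (diagramIdeal T k n).toIdeal (MvPolynomial.X v) ∈
        p.asHomogeneousIdeal.toIdeal := by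
    rintro (i | j)
    · obtain ⟨N, hN⟩ : ∃ N : ℕ, Finsupp.single i N ∉ T.boxes := by
        by_contra! hc
        exact (Set.infinite_of_injective_forall_mem (Finsupp.single_injective i) hc)
          T.boxes.finite_toSet
      refine p.isPrime.mem_of_pow_mem N ?_
      have h0 : Ideal.Quotient.mk (diagramIdeal T k n).toIdeal
          (boxMonomial k n (Finsupp.single i N)) = 0 :=
        Ideal.Quotient.eq_zero_iff_mem.mpr (Ideal.subset_span ⟨_, hN, rfl⟩)
      have h1 : boxMonomial (m := m) k n (Finsupp.single i N) = MvPolynomial.X (Sum.inl i) ^ N := by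
        unfold boxMonomial
        rw [Finset.prod_eq_single i]
        · simp
        · intro j _ hj
          simp [Finsupp.single_eq_of_ne hj]
        · simp
      rw [← map_pow, ← h1, h0]
      exact zero_mem _
    · have hX : (MvPolynomial.X j : MvPolynomial (Fin (n + 1)) k) ∈
          HomogeneousIdeal.irrelevant (baseGrading k n) := by
        rw [HomogeneousIdeal.mem_irrelevant_iff, GradedRing.proj_apply,
          DirectSum.decompose_of_mem_ne _ (MvPolynomial.isHomogeneous_X k j) one_ne_zero]
      have h2 : coordinateMap T k n (MvPolynomial.X j) ∈ p.asHomogeneousIdeal := h hX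
      have h3 : coordinateMap T k n (MvPolynomial.X j) =
          Ideal.Quotient.mk (diagramIdeal T k n).toIdeal (MvPolynomial.X (Sum.inr j)) :=
        congrArg (Ideal.Quotient.mk _) (MvPolynomial.rename_X _ _)
      exact h3 ▸ h2
  have : (HomogeneousIdeal.irrelevant (diagramGrading T k n)).toIdeal ≤
      p.asHomogeneousIdeal.toIdeal := by
    rw [HomogeneousIdeal.toIdeal_irrelevant_le]
    rintro i hi _ ⟨q, hq, rfl⟩
    have hq' : q ∈ Ideal.span (MvPolynomial.X '' (Set.univ : Set (Fin m ⊕ Fin (n + 1)))) := by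
      rw [MvPolynomial.mem_ideal_span_X_image]
      intro d hd
      by_contra! hc
      have hd0 : d = 0 := Finsupp.ext fun v => hc v trivial
      have := (MvPolynomial.mem_homogeneousSubmodule _ _).mp hq (MvPolynomial.mem_support_iff.mp hd)
      simp [hd0] at this
      omega
    have hle : Ideal.span (MvPolynomial.X '' (Set.univ : Set (Fin m ⊕ Fin (n + 1)))) ≤
        p.asHomogeneousIdeal.toIdeal.comap (Ideal.Quotient.mk (diagramIdeal T k n).toIdeal) := by
      rw [Ideal.span_le]
      rintro _ ⟨v, _, rfl⟩
      exact key v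
    exact hle hq'
  exact this

/-- The restriction to `Y` of the linear projection `[x : z] ↦ [z]` from `ℙ^{n+m}` minus the linear
subspace `z_0 = ⋯ = z_n = 0` (which does not meet `Y`) onto `X`. -/
def projection : multipleScheme T k n ⟶ projectiveSpace k n :=
  ProjGen.map (coordinateMap T k n) (coordinateMap_irrelevant T k n)

/-- The line bundle `𝒪_X(d)` on `X = ℙⁿ`. -/
abbrev lineBundle (d : ℤ) : (projectiveSpace k n).Modules :=
  serreTwist (baseGrading k n) d

/-- The values of a section `t` of `𝒪_Y` in the localizations of `S / J`. -/
abbrev valueOn (U : (projectiveSpace k n).Opens)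
    (t : Γ(multipleScheme T k n, projection T k n ⁻¹ᵁ U))
    (y : (projection T k n ⁻¹ᵁ U : (multipleScheme T k n).Opens)) : Loc (diagramGrading T k n) y.1 :=
  stalkValue (diagramGrading T k n) (projection T k n ⁻¹ᵁ U) t y

/-- The value at `y ∈ Y` of `s x^B`, where `s = a / b` is a section of `𝒪_X(d)`: this is
`a x^B / b` in the localization of `S / J` at `y`. -/
def timesMonomial {d : ℤ} (B : Fin m →₀ ℕ) (U : (projectiveSpace k n).Opens)
    (s : twistSections (baseGrading k n) d U)
    (y : (projection T k n ⁻¹ᵁ U : (multipleScheme T k n).Opens)) : Loc (diagramGrading T k n) y.1 :=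
  locMap (coordinateMap T k n) (coordinateMap_irrelevant T k n) y.1
      (s.1 ⟨projection T k n y.1, y.2⟩) *
    algebraMap _ (Loc (diagramGrading T k n) y.1)
      (Ideal.Quotient.mk (diagramIdeal T k n).toIdeal (boxMonomial k n B))

end Diagram

end MonomialScheme

end

open MonomialScheme

attribute [local instance] CategoryTheory.Abelian.hasFiniteBiproducts

/-! Everything rests on one fact of algebra: `S / J` is free over `k[z]` with basis the monomials
`x^B`, `B ∈ T`. Viewing `S` as `k[z][x]`, the monomials outside `T` die in the quotient, so the
boxes span (`toCoordinateRing_eq_sum`). A member of the monomial ideal `J` has zero coefficient at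
every box because `T` is a lower set, so the boxes are independent (`boxCoeff_eq_zero_of_mem`).

To carry this to `Proj`, denominators must be moved into `k[z]`. As `T` is finite, each `x_i` is
nilpotent in `S / J`, so `f` and its `x`-free part `f_0` differ by a nilpotent. Hence a prime of `S
/ J` contains `f` exactly when its trace on `k[z]` contains `f_0`, and the topology of `Y` comes
from `X`. Some multiple of `f` is a power of `f_0`, with degrees under control
(`exists_mul_eq_pow`). So the map `∑ s_B e_B ↦ ∑ s_B x^B` on full localizations is injective
(`fibreHom_injective`), and every degree-zero fraction is the image of a family of fractions of
degrees `-w_B` (`exists_fibreHom_mk_eq`).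

On sections, injectivity is checked fibrewise, since every point of `X` lifts to `Y` when `T` is
nonempty. For surjectivity, local lifts exist and glue because they are unique
(`boxSectionsMap_bijective`). This gives the isomorphism of algebras. The inclusions and coefficient
projections of the summands, transported along it, exhibit the push-forward as a biproduct, which
gives the isomorphism of modules. -/

namespace MonomialScheme

/-! ### Homomorphisms out of the truncated polynomial ring -/

section BoxSumLift

namespace YoungDiag

variable {m : ℕ} {T : YoungDiag m} {R Q : Type u} [CommRing R] [CommRing Q]

/-- Over the union of `T` and the support of `p`, the extra terms vanish on either side: off the
support the coefficient is zero, off `T` the monomial is. As `truncate` is surjective and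
multiplicative, this reduces the ring axioms for `boxSumLift` to those of `eval₂`. -/
lemma sum_truncate (g : R →+* Q) (x : Fin m → Q)
    (hx : ∀ B ∉ T.boxes, ∏ i, x i ^ B i = 0) (p : MvPolynomial (Fin m) R) :
    ∑ B : T.boxes, g (truncate (T := T) p B) * ∏ i, x i ^ B.1 i = MvPolynomial.eval₂ g x p := by
  classical
  rw [MvPolynomial.eval₂_eq']
  change ∑ B : T.boxes, g (p.coeff B.1) * ∏ i, x i ^ B.1 i = _
  rw [Finset.sum_coe_sort T.boxes (fun B => g (p.coeff B) * ∏ i, x i ^ B i),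
    Finset.sum_subset (Finset.subset_union_left (s₂ := p.support)),
    ← Finset.sum_subset (Finset.subset_union_right (s₁ := T.boxes))]
  · intro B _ hB
    rw [MvPolynomial.notMem_support_iff.mp hB, map_zero, zero_mul]
  · intro B _ hB
    rw [hx B hB, mul_zero]

/-- The ring homomorphism `⨁_B R e_B → Q`, `r e_B ↦ g(r) x^B`, for a family `x` of elements of `Q`
whose monomials outside of the diagram vanish. -/
noncomputable def boxSumLift (g : R →+* Q) (x : Fin m → Q)
    (hx : ∀ B ∉ T.boxes, ∏ i, x i ^ B i = 0) : T.BoxSum R →+* Q where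
  toFun v := ∑ B : T.boxes, g (v B) * ∏ i, x i ^ B.1 i
  map_one' := by
    rw [← truncate_one, sum_truncate g x hx, MvPolynomial.eval₂_one]
  map_zero' := by
    rw [← truncate_zero, sum_truncate g x hx, MvPolynomial.eval₂_zero]
  map_add' a b := by
    obtain ⟨a, rfl⟩ := truncate_surjective a
    obtain ⟨b, rfl⟩ := truncate_surjective b
    rw [← truncate_add]
    simp only [sum_truncate g x hx, MvPolynomial.eval₂_add]
  map_mul' a b := by
    obtain ⟨a, rfl⟩ := truncate_surjective a
    obtain ⟨b, rfl⟩ := truncate_surjective b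
    rw [← truncate_mul]
    simp only [sum_truncate g x hx, MvPolynomial.eval₂_mul]

lemma boxSumLift_truncate (g : R →+* Q) (x : Fin m → Q)
    (hx : ∀ B ∉ T.boxes, ∏ i, x i ^ B i = 0) (p : MvPolynomial (Fin m) R) :
    boxSumLift g x hx (truncate p) = MvPolynomial.eval₂ g x p := sum_truncate g x hx p

lemma constant_eq_truncate (r : R) : constant T R r = truncate (MvPolynomial.C r) := by
  funext C
  change (if C.1 = 0 then r else 0) = MvPolynomial.coeff C.1 (MvPolynomial.C r)
  rw [MvPolynomial.coeff_C]
  simp only [eq_comm]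

lemma boxSumLift_constant (g : R →+* Q) (x : Fin m → Q)
    (hx : ∀ B ∉ T.boxes, ∏ i, x i ^ B i = 0) (r : R) :
    boxSumLift g x hx (constant T R r) = g r := by
  rw [constant_eq_truncate, boxSumLift_truncate, MvPolynomial.eval₂_C]

end YoungDiag

end BoxSumLift

/-! ### `S / J` as a free `k[z]`-module, and nilpotence of the `x_i` -/

section CoordinateRing

variable {m : ℕ} (T : YoungDiag m) (k : Type u) [Field k] (n : ℕ)

/-- The coefficient of `x^B` of a polynomial in the variables `x` and `z`. -/
noncomputable def boxCoeff (B : Fin m →₀ ℕ) (f : MvPolynomial (Fin m ⊕ Fin (n + 1)) k) :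
    MvPolynomial (Fin (n + 1)) k :=
  (MvPolynomial.sumAlgEquiv k (Fin m) (Fin (n + 1)) f).coeff B

/-- By additivity it is enough to treat monomials. This link between `k[z][x]` and `S` is what
allows degrees to be counted. -/
lemma coeff_boxCoeff (B : Fin m →₀ ℕ) (d : Fin (n + 1) →₀ ℕ)
    (f : MvPolynomial (Fin m ⊕ Fin (n + 1)) k) :
    (boxCoeff k n B f).coeff d = f.coeff (B.sumElim d) := by
  rw [boxCoeff]
  induction f using MvPolynomial.induction_on' with
  | monomial e a =>
    have h : MvPolynomial.sumAlgEquiv k (Fin m) (Fin (n + 1)) (MvPolynomial.monomial e a) =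
        MvPolynomial.monomial (Finsupp.sumFinsuppEquivProdFinsupp e).1
          (MvPolynomial.monomial (Finsupp.sumFinsuppEquivProdFinsupp e).2 a) := by
      ext
      simp [MvPolynomial.sumAlgEquiv, MvPolynomial.monomial, MvPolynomial.coeff]
    obtain ⟨⟨B', d'⟩, rfl⟩ := Finsupp.sumFinsuppEquivProdFinsupp.symm.surjective e
    have he : B'.sumElim d' = B.sumElim d ↔ B' = B ∧ d' = d :=
      ⟨fun h => ⟨Finsupp.ext fun i => DFunLike.congr_fun h (Sum.inl i),
        Finsupp.ext fun j => DFunLike.congr_fun h (Sum.inr j)⟩, by rintro ⟨rfl, rfl⟩; rfl⟩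
    rw [h, Equiv.apply_symm_apply, MvPolynomial.coeff_monomial, MvPolynomial.coeff_monomial]
    by_cases h1 : B' = B
    · subst h1
      simp [he, MvPolynomial.coeff_monomial]
    · simp [he, h1]
  | add p q hp hq => simp [hp, hq]

lemma degree_sumElim (B : Fin m →₀ ℕ) (d : Fin (n + 1) →₀ ℕ) :
    Finsupp.weight (1 : Fin m ⊕ Fin (n + 1) → ℕ) (B.sumElim d) = weight B + Finsupp.weight 1 d := by
  simp [Finsupp.weight_apply, Finsupp.sum_fintype, weight]

lemma boxCoeff_eq_zero {B : Fin m →₀ ℕ} {i : ℕ} {f : MvPolynomial (Fin m ⊕ Fin (n + 1)) k}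
    (hf : f ∈ ambientGrading k n m i) (h : i < weight B) : boxCoeff k n B f = 0 := by
  ext d
  rw [coeff_boxCoeff, MvPolynomial.coeff_zero]
  by_contra h0
  have h1 := (MvPolynomial.mem_homogeneousSubmodule _ _).mp hf h0
  rw [degree_sumElim] at h1
  omega

/-- A monomial `z^d` that occurs satisfies `w_B + |d| = i`. The truncated subtraction is harmless:
for `i < w_B` the coefficient is zero. -/
lemma boxCoeff_mem {B : Fin m →₀ ℕ} {i : ℕ} {f : MvPolynomial (Fin m ⊕ Fin (n + 1)) k}
    (hf : f ∈ ambientGrading k n m i) : boxCoeff k n B f ∈ baseGrading k n (i - weight B) := by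
  refine (MvPolynomial.mem_homogeneousSubmodule _ _).mpr fun d hd => ?_
  rw [coeff_boxCoeff] at hd
  have h1 := (MvPolynomial.mem_homogeneousSubmodule _ _).mp hf hd
  rw [degree_sumElim] at h1
  omega

/-- The quotient map onto the homogeneous coordinate ring of the multiple scheme. -/
noncomputable abbrev toCoordinateRing : MvPolynomial (Fin m ⊕ Fin (n + 1)) k →+*
    MvPolynomial (Fin m ⊕ Fin (n + 1)) k ⧸ (diagramIdeal T k n).toIdeal :=
  Ideal.Quotient.mk (diagramIdeal T k n).toIdeal

lemma toCoordinateRing_boxMonomial (B : Fin m →₀ ℕ) :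
    toCoordinateRing T k n (boxMonomial k n B) =
      ∏ i, toCoordinateRing T k n (MvPolynomial.X (Sum.inl i)) ^ B i := by
  simp only [boxMonomial, map_prod, map_pow]

lemma prod_toCoordinateRing_eq_zero (B : Fin m →₀ ℕ) (hB : B ∉ T.boxes) :
    ∏ i, toCoordinateRing T k n (MvPolynomial.X (Sum.inl i)) ^ B i = 0 := by
  rw [← toCoordinateRing_boxMonomial]
  exact Ideal.Quotient.eq_zero_iff_mem.mpr (Ideal.subset_span ⟨B, hB, rfl⟩)

lemma coordinateMap_apply (a : MvPolynomial (Fin (n + 1)) k) :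
    coordinateMap T k n a = toCoordinateRing T k n (MvPolynomial.rename Sum.inr a) := rfl

lemma coordinateMap_toRingHom_apply (a : MvPolynomial (Fin (n + 1)) k) :
    (coordinateMap T k n).toRingHom a = coordinateMap T k n a := rfl

/-- The spanning half of freeness. The quotient map is evaluation of a polynomial over `k[z]` at the
classes of the `x_i`, and `sum_truncate` discards the monomials outside `T`. -/
lemma toCoordinateRing_eq_sum (f : MvPolynomial (Fin m ⊕ Fin (n + 1)) k) :
    toCoordinateRing T k n f = ∑ B : T.boxes, coordinateMap T k n (boxCoeff k n B.1 f) *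
      toCoordinateRing T k n (boxMonomial k n B.1) := by
  have h := YoungDiag.sum_truncate (T := T) (coordinateMap T k n).toRingHom _
    (prod_toCoordinateRing_eq_zero T k n) (MvPolynomial.sumAlgEquiv k _ _ f)
  simp only [toCoordinateRing_boxMonomial]
  refine Eq.trans ?_ h.symm
  refine congrFun (congrArg DFunLike.coe (?_ : toCoordinateRing T k n =
    (MvPolynomial.eval₂Hom (coordinateMap T k n).toRingHom fun i =>
      toCoordinateRing T k n (MvPolynomial.X (Sum.inl i))).comp
      (MvPolynomial.sumAlgEquiv k (Fin m) (Fin (n + 1))).toRingEquiv.toRingHom)) f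
  refine MvPolynomial.ringHom_ext (fun r => ?_) ?_
  · simp [coordinateMap_toRingHom_apply, coordinateMap_apply]
  · rintro (i | j) <;> simp [coordinateMap_toRingHom_apply, coordinateMap_apply]

lemma sumAlgEquiv_boxMonomial (B : Fin m →₀ ℕ) :
    MvPolynomial.sumAlgEquiv k (Fin m) (Fin (n + 1)) (boxMonomial k n B) =
      MvPolynomial.monomial B 1 := by
  rw [boxMonomial, map_prod, MvPolynomial.monomial_eq, map_one, one_mul,
    Finsupp.prod_fintype _ _ (by simp)]
  simp

/-- The independence half of freeness. Each `x`-monomial occurring in an element of `J` is divisible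
by some `x^C` with `C ∉ T`; if it were `x^B` with `B ∈ T`, then `C ≤ B` would force `C ∈ T`. -/
lemma boxCoeff_eq_zero_of_mem {f : MvPolynomial (Fin m ⊕ Fin (n + 1)) k}
    (hf : f ∈ (diagramIdeal T k n).toIdeal) {B : Fin m →₀ ℕ} (hB : B ∈ T.boxes) :
    boxCoeff k n B f = 0 := by
  change f ∈ Ideal.span (boxMonomial k n '' {B | B ∉ T.boxes}) at hf
  have h := Ideal.mem_map_of_mem (MvPolynomial.sumAlgEquiv k (Fin m) (Fin (n + 1))) hf
  rw [Ideal.map_span, ← Set.image_comp] at h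
  simp only [Function.comp_def, sumAlgEquiv_boxMonomial] at h
  rw [MvPolynomial.mem_ideal_span_monomial_image] at h
  by_contra h0
  obtain ⟨C, hC, hCB⟩ := h B (MvPolynomial.mem_support_iff.mpr h0)
  exact hC (T.isLowerSet hCB hB)

lemma isNilpotent_toCoordinateRing_X (i : Fin m) :
    IsNilpotent (toCoordinateRing T k n (MvPolynomial.X (Sum.inl i))) := by
  obtain ⟨N, hN⟩ : ∃ N : ℕ, Finsupp.single i N ∉ T.boxes := by
    -- The boxes on an axis are pairwise distinct, so the finite set `T` cannot contain them all.
    by_contra! hc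
    exact (Set.infinite_of_injective_forall_mem (Finsupp.single_injective i) hc)
      T.boxes.finite_toSet
  refine ⟨N, ?_⟩
  rw [← prod_toCoordinateRing_eq_zero T k n _ hN, Finset.prod_eq_single i]
  · simp
  · intro j _ hj
    simp [Finsupp.single_eq_of_ne hj]
  · simp

/-- Modulo the nilradical the `x_i` vanish, so `f` reduces to its `x`-free part; two ring
homomorphisms are compared on constants and variables. -/
lemma isNilpotent_sub (f : MvPolynomial (Fin m ⊕ Fin (n + 1)) k) :
    IsNilpotent (coordinateMap T k n (boxCoeff k n 0 f) - toCoordinateRing T k n f) := by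
  rw [← mem_nilradical, ← Ideal.Quotient.eq]
  refine congrFun (congrArg DFunLike.coe (?_ :
    (Ideal.Quotient.mk (nilradical _)).comp (((coordinateMap T k n).toRingHom.comp
      MvPolynomial.constantCoeff).comp
      (MvPolynomial.sumAlgEquiv k (Fin m) (Fin (n + 1))).toRingEquiv.toRingHom) =
    (Ideal.Quotient.mk (nilradical _)).comp (toCoordinateRing T k n))) f
  refine MvPolynomial.ringHom_ext (fun r => ?_) ?_
  · simp [coordinateMap_apply]
  · rintro (i | j)
    · have := (mem_nilradical.mpr (isNilpotent_toCoordinateRing_X T k n i))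
      simp [Ideal.Quotient.eq_zero_iff_mem.mpr this]
    · simp [coordinateMap_apply]

/-- This trades a denominator in `S / J` for one in `k[z]`. With `e` the `x`-free part of `f`, the
difference `e - f` is nilpotent modulo `J`, and `f = e - (e - f)` divides `e^(N+1) - (e - f)^(N+1)`
by the geometric sum. The exponent `N + 1` instead of `N` gives the cofactor degree `N * i`, without
subtraction. -/
lemma exists_mul_eq_pow (f : MvPolynomial (Fin m ⊕ Fin (n + 1)) k) :
    ∃ (N : ℕ) (c : MvPolynomial (Fin m ⊕ Fin (n + 1)) k),
      toCoordinateRing T k n c * toCoordinateRing T k n f =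
        coordinateMap T k n (boxCoeff k n 0 f ^ (N + 1)) ∧
      ∀ i, f ∈ ambientGrading k n m i → c ∈ ambientGrading k n m (N * i) := by
  obtain ⟨N, hN⟩ := isNilpotent_sub T k n f
  set e : MvPolynomial (Fin m ⊕ Fin (n + 1)) k :=
    MvPolynomial.rename Sum.inr (boxCoeff k n 0 f) with he
  refine ⟨N, ∑ j ∈ Finset.range (N + 1), e ^ j * (e - f) ^ (N + 1 - 1 - j), ?_, fun i hf => ?_⟩
  · have h := geom_sum₂_mul e (e - f) (N + 1)
    rw [sub_sub_cancel] at h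
    rw [← map_mul, h, map_sub, map_pow, map_pow, map_sub, ← coordinateMap_apply,
      pow_succ (_ - _) N, hN, zero_mul, sub_zero, ← map_pow]
  · have h0 : e ∈ ambientGrading k n m i := by
      have := boxCoeff_mem k n (B := 0) hf
      rw [show weight (0 : Fin m →₀ ℕ) = 0 by simp [weight], Nat.sub_zero] at this
      exact MvPolynomial.IsHomogeneous.rename_isHomogeneous this
    refine sum_mem fun j hj => ?_
    have h1 := SetLike.mul_mem_graded (SetLike.pow_mem_graded j h0)
      (SetLike.pow_mem_graded (N + 1 - 1 - j) (sub_mem h0 hf))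
    rw [Finset.mem_range] at hj
    rwa [smul_eq_mul, smul_eq_mul, ← add_mul, show j + (N + 1 - 1 - j) = N by omega] at h1

end CoordinateRing

end MonomialScheme

/-! ### Points and fibres of the projection `Y → X` -/

namespace MonomialScheme

section LocalizationMap

variable {A B σ τ : Type u} [CommRing A] [SetLike σ A] [AddSubgroupClass σ A]
  [CommRing B] [SetLike τ B] [AddSubgroupClass τ B]
  {𝒜 : ℕ → σ} {ℬ : ℕ → τ} [GradedRing 𝒜] [GradedRing ℬ] (f : 𝒜 →+*ᵍ ℬ)
  (hf : ∀ p : ProjectiveSpectrum ℬ, ¬ HomogeneousIdeal.irrelevant 𝒜 ≤ p.asHomogeneousIdeal.comap f)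

lemma locMap_mk (y : ProjectiveSpectrum ℬ) (a b : A)
    (hb : b ∉ (ProjGen.comap f hf y).asHomogeneousIdeal) :
    locMap f hf y (Localization.mk a ⟨b, hb⟩) = Localization.mk (f a) ⟨f b, hb⟩ :=
  Localization.localRingHom_mk _ _ _ _ _ _

end LocalizationMap

variable {m : ℕ} (T : YoungDiag m) (k : Type u) [Field k] (n : ℕ)

/-- The projection from the multiple scheme to projective space, on points. -/
noncomputable abbrev projectPoint :
    C(ProjectiveSpectrum (diagramGrading T k n), ProjectiveSpectrum (baseGrading k n)) :=
  ProjGen.comap (coordinateMap T k n) (coordinateMap_irrelevant T k n)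

section Points

variable {T k n}

/-- The two elements differ by a nilpotent, which lies in every prime. -/
lemma boxCoeff_zero_mem_iff {y : ProjectiveSpectrum (diagramGrading T k n)}
    {f : MvPolynomial (Fin m ⊕ Fin (n + 1)) k} :
    boxCoeff k n 0 f ∈ (projectPoint T k n y).asHomogeneousIdeal ↔
      toCoordinateRing T k n f ∈ y.asHomogeneousIdeal := by
  obtain ⟨N, hN⟩ := isNilpotent_sub T k n f
  have h : coordinateMap T k n (boxCoeff k n 0 f) - toCoordinateRing T k n f ∈
      y.asHomogeneousIdeal.toIdeal :=
    y.isPrime.mem_of_pow_mem N (hN ▸ zero_mem _)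
  exact ⟨fun h1 => (Submodule.sub_mem_iff_right y.asHomogeneousIdeal.toIdeal h1).mp h,
    fun h1 => (Submodule.sub_mem_iff_left y.asHomogeneousIdeal.toIdeal h1).mp h⟩

lemma zero_mem_boxes (hT : T.boxes.Nonempty) : (0 : Fin m →₀ ℕ) ∈ T.boxes :=
  T.isLowerSet zero_le hT.choose_spec

/-- The retraction `S / J → k[z_0, …, z_n]`, `x_i ↦ 0`, for a nonempty diagram. -/
noncomputable def coordinateRetraction (hT : T.boxes.Nonempty) :
    diagramGrading T k n →+*ᵍ baseGrading k n where
  toRingHom := Ideal.Quotient.lift _ (MvPolynomial.constantCoeff.comp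
      (MvPolynomial.sumAlgEquiv k (Fin m) (Fin (n + 1))).toRingEquiv.toRingHom)
    fun _ hf => boxCoeff_eq_zero_of_mem T k n hf (zero_mem_boxes hT)
  map_mem := by
    rintro i _ ⟨f, hf, rfl⟩
    have := boxCoeff_mem k n (B := 0) hf
    rwa [show weight (0 : Fin m →₀ ℕ) = 0 by simp [weight], Nat.sub_zero] at this

lemma boxCoeff_rename_mul_boxMonomial (B C : Fin m →₀ ℕ) (a : MvPolynomial (Fin (n + 1)) k) :
    boxCoeff k n C (MvPolynomial.rename Sum.inr a * boxMonomial k n B) = if B = C then a else 0 := by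
  have h := congrArg (fun g => g a)
    (MvPolynomial.sumAlgEquiv_comp_rename_inr (R := k) (S₁ := Fin m) (S₂ := Fin (n + 1)))
  have h' : MvPolynomial.sumAlgEquiv k (Fin m) (Fin (n + 1)) (MvPolynomial.rename Sum.inr a) =
    MvPolynomial.C a := h
  rw [boxCoeff, map_mul, sumAlgEquiv_boxMonomial, h', MvPolynomial.C_mul_monomial, mul_one,
    MvPolynomial.coeff_monomial]

lemma boxCoeff_zero_rename (a : MvPolynomial (Fin (n + 1)) k) :
    boxCoeff k n (0 : Fin m →₀ ℕ) (MvPolynomial.rename Sum.inr a) = a := by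
  have h := boxCoeff_rename_mul_boxMonomial (k := k) (0 : Fin m →₀ ℕ) 0 a
  rwa [if_pos rfl, show boxMonomial k n (0 : Fin m →₀ ℕ) = 1 by simp [boxMonomial], mul_one] at h

lemma coordinateRetraction_coordinateMap (hT : T.boxes.Nonempty)
    (a : MvPolynomial (Fin (n + 1)) k) :
    coordinateRetraction hT (coordinateMap T k n a) = a :=
  boxCoeff_zero_rename a

/-- A homogeneous prime of `k[z]` is lifted by pulling it back along the retraction `x_i ↦ 0`, which
is a left inverse of `coordinateMap`. -/
lemma projectPoint_surjective (hT : T.boxes.Nonempty) :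
    Function.Surjective (projectPoint T k n) := by
  intro q
  have hq : ∀ q : ProjectiveSpectrum (baseGrading k n),
      ¬ HomogeneousIdeal.irrelevant (diagramGrading T k n) ≤
        q.asHomogeneousIdeal.comap (coordinateRetraction hT) := by
    intro q h
    refine q.not_irrelevant_le ((HomogeneousIdeal.irrelevant_le _).mpr fun i hi a ha => ?_)
    have h1 := h (HomogeneousIdeal.mem_irrelevant_of_mem _ hi ((coordinateMap T k n).map_mem ha))
    exact coordinateRetraction_coordinateMap hT a ▸ h1
  refine ⟨ProjGen.comapFun (coordinateRetraction hT) hq q, ?_⟩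
  ext a
  change coordinateRetraction hT (coordinateMap T k n a) ∈ q.asHomogeneousIdeal ↔ _
  rw [coordinateRetraction_coordinateMap]
  exact Iff.rfl

/-- The basic open set of `g` is the preimage of that of its `x`-free part, so neighbourhoods in `Y`
may be shrunk to preimages of open sets of `X`. -/
lemma exists_basicOpen_preimage_subset {y : ProjectiveSpectrum (diagramGrading T k n)}
    {W : Opens (ProjectiveSpectrum (diagramGrading T k n))} (hy : y ∈ W) :
    ∃ f : MvPolynomial (Fin (n + 1)) k,
      f ∉ (projectPoint T k n y).asHomogeneousIdeal ∧
      ∀ y', f ∉ (projectPoint T k n y').asHomogeneousIdeal → y' ∈ W := by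
  obtain ⟨_, ⟨g, rfl⟩, hg, hgW⟩ :=
    (ProjectiveSpectrum.isTopologicalBasis_basic_opens (diagramGrading T k n)).exists_subset_of_mem_open
      hy W.isOpen
  obtain ⟨g, rfl⟩ := Ideal.Quotient.mk_surjective g
  exact ⟨boxCoeff k n 0 g, fun h => hg (boxCoeff_zero_mem_iff.mp h),
    fun y' h => hgW fun h' => h (boxCoeff_zero_mem_iff.mpr h')⟩

end Points

/-- The homomorphism from the fibre of `⨁_B 𝒪(-w_B) e_B` at the image of `y` to the local ring of the
multiple scheme at `y`, on full localizations. -/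
noncomputable def fibreHom (y : ProjectiveSpectrum (diagramGrading T k n)) :
    T.BoxSum (Loc (baseGrading k n) (projectPoint T k n y)) →+* Loc (diagramGrading T k n) y :=
  YoungDiag.boxSumLift (locMap (coordinateMap T k n) (coordinateMap_irrelevant T k n) y)
    (fun i => algebraMap _ _ (toCoordinateRing T k n (MvPolynomial.X (Sum.inl i))))
    fun B hB => by
      refine Eq.trans ?_ ((congrArg (algebraMap _ (Loc (diagramGrading T k n) y))
        (prod_toCoordinateRing_eq_zero T k n B hB)).trans (map_zero _))
      simp only [map_prod, map_pow]

variable {T k n}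

lemma fibreHom_apply (y : ProjectiveSpectrum (diagramGrading T k n))
    (v : T.BoxSum (Loc (baseGrading k n) (projectPoint T k n y))) :
    fibreHom T k n y v = ∑ B : T.boxes,
      locMap (coordinateMap T k n) (coordinateMap_irrelevant T k n) y (v B) *
        algebraMap _ _ (toCoordinateRing T k n (boxMonomial k n B.1)) := by
  simp only [toCoordinateRing_boxMonomial, map_prod, map_pow]
  rfl

lemma fibreHom_mk (y : ProjectiveSpectrum (diagramGrading T k n))
    (a : T.boxes → MvPolynomial (Fin (n + 1)) k) (b : MvPolynomial (Fin (n + 1)) k)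
    (hb : b ∉ (projectPoint T k n y).asHomogeneousIdeal) :
    fibreHom T k n y (fun B => Localization.mk (a B) ⟨b, hb⟩) =
      Localization.mk (∑ B : T.boxes, coordinateMap T k n (a B) *
        toCoordinateRing T k n (boxMonomial k n B.1)) ⟨coordinateMap T k n b, hb⟩ := by
  refine (fibreHom_apply y _).trans ?_
  rw [Localization.mk_sum]
  refine Finset.sum_congr rfl fun B _ => ?_
  rw [locMap_mk, ← Localization.mk_one_eq_algebraMap, Localization.mk_mul, mul_one]

/-- Linear independence of the `x^B` over `k[z]`: a lift of the sum to `S` lies in `J`, and its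
coefficient at `B` is `a B`. -/
lemma coordinateMap_sum_eq_zero {a : T.boxes → MvPolynomial (Fin (n + 1)) k}
    (h : ∑ B : T.boxes, coordinateMap T k n (a B) *
        toCoordinateRing T k n (boxMonomial k n B.1) = 0) (B : T.boxes) : a B = 0 := by
  simp only [coordinateMap_apply, ← map_mul, ← map_sum] at h
  have h1 := boxCoeff_eq_zero_of_mem T k n (Ideal.Quotient.eq_zero_iff_mem.mp h) B.2
  rw [boxCoeff, map_sum, MvPolynomial.coeff_sum] at h1
  change ∑ C : T.boxes, boxCoeff k n B.1 (MvPolynomial.rename Sum.inr (a C) *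
    boxMonomial k n C.1) = 0 at h1
  simp only [boxCoeff_rename_mul_boxMonomial] at h1
  rw [Finset.sum_eq_single B, if_pos rfl] at h1
  · exact h1
  · intro C _ hC
    rw [if_neg fun h => hC (Subtype.ext h)]
  · simp

/-- Over a common denominator, an image of zero means that some `g` outside the prime kills the
combination of the `x^B`. Once `g` is replaced by a power of its `x`-free part, independence
applies, and `k[z]` is a domain. -/
lemma fibreHom_injective (y : ProjectiveSpectrum (diagramGrading T k n)) :
    Function.Injective (fibreHom T k n y) := by
  refine (injective_iff_map_eq_zero _).mpr fun v hv => ?_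
  obtain ⟨a, b, hb, rfl⟩ : ∃ (a : T.boxes → MvPolynomial (Fin (n + 1)) k)
      (b : MvPolynomial (Fin (n + 1)) k) (hb : b ∉ (projectPoint T k n y).asHomogeneousIdeal),
      v = fun B => Localization.mk (a B) ⟨b, hb⟩ := by
    obtain ⟨b, hb⟩ := IsLocalization.exist_integer_multiples_of_finite
      (projectPoint T k n y).asHomogeneousIdeal.toIdeal.primeCompl (v : T.boxes → Loc _ _)
    choose a ha using hb
    refine ⟨a, b.1, b.2, funext fun B => ?_⟩
    rw [Localization.mk_eq_mk', IsLocalization.eq_mk'_iff_mul_eq, ha, Algebra.smul_def, mul_comm]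
  rw [fibreHom_mk, Localization.mk_eq_mk', IsLocalization.mk'_eq_zero_iff] at hv
  obtain ⟨⟨g, hg⟩, h⟩ := hv
  obtain ⟨g, rfl⟩ := Ideal.Quotient.mk_surjective g
  obtain ⟨N, c, hc, -⟩ := exists_mul_eq_pow T k n g
  have h1 : ∑ B : T.boxes, coordinateMap T k n (boxCoeff k n 0 g ^ (N + 1) * a B) *
      toCoordinateRing T k n (boxMonomial k n B.1) = 0 := by
    simp only [map_mul (coordinateMap T k n), mul_assoc]
    rw [← Finset.mul_sum, ← hc, mul_assoc]
    exact (congrArg _ h).trans (mul_zero _)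
  have hg0 : boxCoeff k n 0 g ≠ 0 := by
    intro h0
    exact hg (boxCoeff_zero_mem_iff.mp (h0 ▸ zero_mem _))
  funext B
  have h2 := (mul_eq_zero.mp (coordinateMap_sum_eq_zero h1 B)).resolve_left (pow_ne_zero _ hg0)
  rw [h2, Localization.mk_zero]
  rfl

/-- If `e b = b_0^(N+1)`, then `a / b = e a / b_0^(N+1)`, and `e a` is expanded in the basis `x^B`.
The coefficients and the denominator do not depend on `y`, so they define local sections. Vanishing
for `j < w_B` is recorded because there `j - w_B` is not the true degree. -/
lemma exists_fibreHom_mk_eq {i : ℕ} (a b : diagramGrading T k n i) :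
    ∃ (j : ℕ) (c : T.boxes → MvPolynomial (Fin (n + 1)) k) (d : baseGrading k n j),
      (∀ B, c B ∈ baseGrading k n (j - weight B.1)) ∧
      (∀ B : T.boxes, j < weight B.1 → c B = 0) ∧
      ∀ (y : ProjectiveSpectrum (diagramGrading T k n)) (hb : b.1 ∉ y.asHomogeneousIdeal),
        ∃ hd : d.1 ∉ (projectPoint T k n y).asHomogeneousIdeal,
          fibreHom T k n y (fun B => Localization.mk (c B) ⟨d.1, hd⟩) =
            Localization.mk a.1 ⟨b.1, hb⟩ := by
  obtain ⟨_, a, ha, rfl⟩ := a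
  obtain ⟨_, b, hb, rfl⟩ := b
  obtain ⟨N, e, he, he'⟩ := exists_mul_eq_pow T k n b
  have hea : e * a ∈ ambientGrading k n m (N * i + i) := SetLike.mul_mem_graded (he' i hb) ha
  have hb0 : boxCoeff k n 0 b ^ (N + 1) ∈ baseGrading k n (N * i + i) := by
    have h := SetLike.pow_mem_graded (N + 1) (boxCoeff_mem k n (B := 0) hb)
    rwa [show weight (0 : Fin m →₀ ℕ) = 0 by simp [weight], Nat.sub_zero, smul_eq_mul,
      Nat.succ_mul] at h
  refine ⟨N * i + i, fun B => boxCoeff k n B.1 (e * a), ⟨_, hb0⟩, fun B => boxCoeff_mem k n hea,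
    fun B hB => boxCoeff_eq_zero k n hea hB, fun y hy => ?_⟩
  have hd : boxCoeff k n 0 b ^ (N + 1) ∉ (projectPoint T k n y).asHomogeneousIdeal := fun h =>
    hy (boxCoeff_zero_mem_iff.mp ((projectPoint T k n y).isPrime.mem_of_pow_mem _ h))
  refine ⟨hd, ?_⟩
  rw [fibreHom_mk, ← toCoordinateRing_eq_sum, Localization.mk_eq_mk_iff, Localization.r_iff_exists]
  refine ⟨1, ?_⟩
  change 1 * (toCoordinateRing T k n b * toCoordinateRing T k n (e * a)) =
    1 * (coordinateMap T k n (boxCoeff k n 0 b ^ (N + 1)) * toCoordinateRing T k n a)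
  rw [← he, map_mul]
  ring

end MonomialScheme

/-! ### The comparison map on sections and its bijectivity -/

namespace MonomialScheme

section Twist

variable {A σ : Type u} [CommRing A] [SetLike σ A] [AddSubgroupClass σ A] (𝒜 : ℕ → σ) [GradedRing 𝒜]

lemma stalkValue_injective (U : Opens (ProjectiveSpectrum.top 𝒜)) :
    Function.Injective (stalkValue 𝒜 U) := fun _ _ h =>
  Subtype.ext (funext fun x => HomogeneousLocalization.val_injective _ (congrFun h x))

/-- The homogeneous localization of the graded ring at a point of `Proj`. -/
abbrev HomLoc (x : ProjectiveSpectrum 𝒜) : Type u :=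
  HomogeneousLocalization.AtPrime 𝒜 x.asHomogeneousIdeal.toIdeal

/-- The fraction `a / b` of elements of the same degree, at a point where `b` does not vanish. -/
def homFraction (x : ProjectiveSpectrum 𝒜) {i : ℕ} (a b : 𝒜 i) (hb : b.1 ∉ x.asHomogeneousIdeal) :
    HomLoc 𝒜 x :=
  HomogeneousLocalization.mk ⟨i, a, b, hb⟩

lemma val_homFraction (x : ProjectiveSpectrum 𝒜) {i : ℕ} (a b : 𝒜 i)
    (hb : b.1 ∉ x.asHomogeneousIdeal) :
    (homFraction 𝒜 x a b hb).val = (Localization.mk a.1 ⟨b.1, hb⟩ : Loc 𝒜 x) :=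
  HomogeneousLocalization.val_mk _

/-- Values are lifted pointwise to homogeneous localizations. These embed in the full ones, so the
chosen lifts agree with the local fractions. -/
lemma mem_range_stalkValue {U : Opens (ProjectiveSpectrum.top 𝒜)} {s : ∀ x : U, Loc 𝒜 x.1}
    (hs : (locallyFractionOfDegree 𝒜 0).pred s) : s ∈ (stalkValue 𝒜 U).range := by
  have key : ∀ x : U, ∃ c : HomLoc 𝒜 x.1, c.val = s x := by
    intro x
    obtain ⟨V, hx, i, p, q, a, b, h, hb, hr⟩ := hs x
    obtain rfl : p = q := by omega
    exact ⟨homFraction 𝒜 x.1 a b (hb ⟨x, hx⟩),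
      (val_homFraction 𝒜 x.1 a b (hb ⟨x, hx⟩)).trans (hr ⟨x, hx⟩).symm⟩
  choose c hc using key
  refine ⟨⟨c, fun x => ?_⟩, funext hc⟩
  obtain ⟨V, hx, i, p, q, a, b, h, hb, hr⟩ := hs x
  obtain rfl : p = q := by omega
  refine ⟨V, hx, i, p, a, b, hb, fun y => HomogeneousLocalization.val_injective _ ?_⟩
  exact (hc (i y)).trans ((hr y).trans (val_homFraction 𝒜 y.1 a b (hb y)).symm)

lemma lfd_algebraMap {d : ℕ} {a : A} (ha : a ∈ 𝒜 d) (U : Opens (ProjectiveSpectrum.top 𝒜)) :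
    (locallyFractionOfDegree 𝒜 d).pred (fun x : U => algebraMap A (Loc 𝒜 x.1) a) := by
  refine TopCat.PrelocalPredicate.sheafifyOf ⟨d, 0, ⟨a, ha⟩,
    ⟨1, SetLike.one_mem_graded 𝒜⟩, by simp, ?_, ?_⟩
  · exact fun x => (Ideal.ne_top_iff_one _).mp x.1.isPrime.ne_top
  · exact fun x => (Localization.mk_one_eq_algebraMap a).symm

/-- The coefficient of `e_B` of a section of `⨁_B 𝒪(-w_B) e_B`. -/
def boxComponent {m : ℕ} (T : YoungDiag m) (B : T.boxes) (U : Opens (ProjectiveSpectrum.top 𝒜))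
    (s : boxSections 𝒜 T U) : twistSections 𝒜 (-(weight B.1 : ℤ)) U :=
  ⟨fun x => s.1 x B, s.2 B⟩

variable {B τ : Type u} [CommRing B] [SetLike τ B] [AddSubgroupClass τ B]
  {𝒜} {ℬ : ℕ → τ} [GradedRing ℬ] (f : 𝒜 →+*ᵍ ℬ)
  (hf : ∀ p : ProjectiveSpectrum ℬ, ¬ HomogeneousIdeal.irrelevant 𝒜 ≤ p.asHomogeneousIdeal.comap f)

lemma lfd_locMap {d : ℤ} {U : Opens (ProjectiveSpectrum.top 𝒜)} {s : ∀ x : U, Loc 𝒜 x.1}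
    (hs : (locallyFractionOfDegree 𝒜 d).pred s) :
    (locallyFractionOfDegree ℬ d).pred (U := (Opens.map (ProjGen.map f hf).base).obj U)
      (fun y => locMap f hf y.1 (s ⟨ProjGen.comap f hf y.1, y.2⟩)) := by
  intro y
  obtain ⟨V, hx, i, p, q, a, b, h, hb, hr⟩ := hs ⟨ProjGen.comap f hf y.1, y.2⟩
  refine ⟨(Opens.map (ProjGen.map f hf).base).obj V, hx,
    (Opens.map (ProjGen.map f hf).base).map i, p, q, ⟨f a, f.map_mem a.2⟩, ⟨f b, f.map_mem b.2⟩, h,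
    fun z => hb ⟨ProjGen.comap f hf z.1, z.2⟩, fun z => ?_⟩
  refine (congrArg (locMap f hf z.1) (hr ⟨ProjGen.comap f hf z.1, z.2⟩)).trans ?_
  exact locMap_mk f hf z.1 a.1 b.1 (hb ⟨ProjGen.comap f hf z.1, z.2⟩)

lemma lfd_locMap_mul {d : ℤ} {U : Opens (ProjectiveSpectrum.top 𝒜)} {s : ∀ x : U, Loc 𝒜 x.1}
    (hs : (locallyFractionOfDegree 𝒜 d).pred s) {w : ℕ} {b : B} (hb : b ∈ ℬ w)
    {e : ℤ} (hd : d + w = e) :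
    (locallyFractionOfDegree ℬ e).pred (U := (Opens.map (ProjGen.map f hf).base).obj U)
      (fun y => locMap f hf y.1 (s ⟨ProjGen.comap f hf y.1, y.2⟩) * algebraMap B (Loc ℬ y.1) b) :=
  hd ▸ lfd_mul ℬ (lfd_locMap f hf hs) (lfd_algebraMap ℬ hb _)

lemma val_fiberMap (y : ProjectiveSpectrum ℬ)
    (c : HomogeneousLocalization.AtPrime 𝒜 (ProjGen.comap f hf y).asHomogeneousIdeal.toIdeal) :
    (ProjGen.fiberMap f hf y c).val = locMap f hf y c.val :=
  HomogeneousLocalization.val_localRingHom _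

end Twist

variable {m : ℕ} (T : YoungDiag m) (k : Type u) [Field k] (n : ℕ)
variable (U : (projectiveSpace k n).Opens)

/-- The value of a section of `⨁_B 𝒪(-w_B) e_B` in the localizations of `S / J`. -/
noncomputable def boxValue : boxSections (baseGrading k n) T U →+*
    ∀ y : (projection T k n ⁻¹ᵁ U : (multipleScheme T k n).Opens), Loc (diagramGrading T k n) y.1 :=
  RingHom.pi fun y => (fibreHom T k n y.1).comp
    ((Pi.evalRingHom (fun x : U => T.BoxSum (Loc (baseGrading k n) x.1))
      ⟨projection T k n y.1, y.2⟩).comp (boxSections (baseGrading k n) T U).subtype)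

lemma boxMonomial_mem (B : Fin m →₀ ℕ) :
    boxMonomial k n B ∈ ambientGrading k n m (weight B) := by
  refine (MvPolynomial.mem_homogeneousSubmodule _ _).mpr
    (MvPolynomial.IsHomogeneous.prod _ _ _ fun i _ => ?_)
  simpa using (MvPolynomial.isHomogeneous_X k (Sum.inl i)).pow (B i)

lemma toCoordinateRing_boxMonomial_mem (B : Fin m →₀ ℕ) :
    toCoordinateRing T k n (boxMonomial k n B) ∈ diagramGrading T k n (weight B) :=
  ⟨_, boxMonomial_mem k n B, rfl⟩

lemma lfd_timesMonomial {d : ℤ} (B : Fin m →₀ ℕ) (s : twistSections (baseGrading k n) d U)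
    (hd : d + weight B = 0) :
    (locallyFractionOfDegree (diagramGrading T k n) 0).pred (U := projection T k n ⁻¹ᵁ U)
      (timesMonomial T k n B U s) := by
  exact lfd_locMap_mul (coordinateMap T k n) (coordinateMap_irrelevant T k n) s.2
    (toCoordinateRing_boxMonomial_mem T k n B) hd

lemma boxValue_eq_sum (s : boxSections (baseGrading k n) T U) :
    boxValue T k n U s = fun y => ∑ B : T.boxes, timesMonomial T k n B.1 U
      (boxComponent (baseGrading k n) T B U s) y :=
  funext fun y => fibreHom_apply y.1 (s.1 ⟨projection T k n y.1, y.2⟩)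

/-- Each term `s_B x^B` has degree `-w_B + w_B = 0`. -/
lemma lfd_boxValue (s : boxSections (baseGrading k n) T U) :
    (locallyFractionOfDegree (diagramGrading T k n) 0).pred (boxValue T k n U s) := by
  refine (congrArg (locallyFractionOfDegree (diagramGrading T k n) 0).pred
    (boxValue_eq_sum T k n U s)).mpr ?_
  exact lfd_sum (diagramGrading T k n) Finset.univ
    (fun (B : T.boxes) => timesMonomial T k n B.1 U
      (boxComponent (baseGrading k n) T B U s))
    fun B => lfd_timesMonomial T k n U B.1 _ (neg_add_cancel _)

/-- The structure sheaf of the multiple scheme, as the ring of its functions with values in the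
localizations of `S / J`. -/
noncomputable def stalkValueEquiv (V : (multipleScheme T k n).Opens) :
    Γ(multipleScheme T k n, V) ≃+* (stalkValue (diagramGrading T k n) V).range :=
  RingEquiv.ofBijective (stalkValue (diagramGrading T k n) V).rangeRestrict
    ⟨fun _ _ h => stalkValue_injective _ V (congrArg Subtype.val h),
      RingHom.rangeRestrict_surjective _⟩

/-- The map `(s_B)_B ↦ ∑_B s_B x^B` on sections. -/
noncomputable def boxSectionsMap :
    boxSections (baseGrading k n) T U →+* Γ(multipleScheme T k n, projection T k n ⁻¹ᵁ U) :=
  (stalkValueEquiv T k n (projection T k n ⁻¹ᵁ U)).symm.toRingHom.comp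
    ((boxValue T k n U).codRestrict _ fun s => mem_range_stalkValue _ (lfd_boxValue T k n U s))

lemma valueOn_boxSectionsMap (s : boxSections (baseGrading k n) T U) :
    stalkValue (diagramGrading T k n) (projection T k n ⁻¹ᵁ U) (boxSectionsMap T k n U s) =
      boxValue T k n U s :=
  congrArg Subtype.val ((stalkValueEquiv T k n (projection T k n ⁻¹ᵁ U)).apply_symm_apply
    ⟨boxValue T k n U s, mem_range_stalkValue _ (lfd_boxValue T k n U s)⟩)

variable {T k n U}

lemma boxSectionsMap_eq_iff {s : boxSections (baseGrading k n) T U}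
    {t : Γ(multipleScheme T k n, projection T k n ⁻¹ᵁ U)} :
    boxSectionsMap T k n U s = t ↔ ∀ y, boxValue T k n U s y = valueOn T k n U t y :=
  (stalkValue_injective _ _).eq_iff.symm.trans <|
    (Eq.congr_left (valueOn_boxSectionsMap T k n U s)).trans funext_iff

lemma boxValue_injective : Function.Injective (boxValue T k n U) := by
  intro s s' h
  refine Subtype.ext (funext fun x => ?_)
  -- For empty `T` there are no points of `Y` to test on, but also no components to compare.
  rcases T.boxes.eq_empty_or_nonempty with hT | hT
  · exact funext fun B => absurd B.2 (by simp [hT])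
  · obtain ⟨x, hx⟩ := x
    obtain ⟨y, rfl⟩ := projectPoint_surjective hT x
    exact fibreHom_injective y (congrFun h ⟨y, hx⟩)

/-- Near a point over `x`, `t` is a single fraction `a / b`; it is valid on the preimage of a
neighbourhood of `x`, where it is rewritten over `k[z]`. -/
lemma exists_local_boxSection (hT : T.boxes.Nonempty)
    (t : Γ(multipleScheme T k n, projection T k n ⁻¹ᵁ U)) (x : U) :
    ∃ (V : Opens (ProjectiveSpectrum.top (baseGrading k n))) (_ : x.1 ∈ V) (i : V ⟶ U)
      (s : ∀ x : V, T.BoxSum (Loc (baseGrading k n) x.1)),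
      (boxPredicate (baseGrading k n) T).pred s ∧
      ∀ (y : ProjectiveSpectrum (diagramGrading T k n)) (hy : projectPoint T k n y ∈ V),
        fibreHom T k n y (s ⟨_, hy⟩) = valueOn T k n U t ⟨y, i.le hy⟩ := by
  obtain ⟨x, hx⟩ := x
  obtain ⟨y, rfl⟩ := projectPoint_surjective hT x
  obtain ⟨W, hW, i, p, a, b, hb, hr⟩ := t.2 ⟨y, hx⟩
  obtain ⟨f, hf, hfW⟩ := exists_basicOpen_preimage_subset hW
  obtain ⟨j, c, d, hc, hc0, h⟩ := exists_fibreHom_mk_eq a b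
  -- The nonvanishing of `d` is known only below points of `Y`, hence everywhere on this set by
  -- surjectivity on points.
  have hd : ∀ x : (U ⊓ ProjectiveSpectrum.basicOpen (baseGrading k n) f : Opens _),
      d.1 ∉ x.1.asHomogeneousIdeal := by
    rintro ⟨x, hx⟩
    obtain ⟨y', rfl⟩ := projectPoint_surjective hT x
    exact (h y' (hb ⟨y', hfW y' hx.2⟩)).choose
  refine ⟨U ⊓ ProjectiveSpectrum.basicOpen (baseGrading k n) f, ⟨hx, hf⟩, Opens.infLELeft _ _,
    fun x B => Localization.mk (c B) ⟨d.1, hd x⟩, fun B => ?_, fun y' hy' => ?_⟩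
  -- No fraction over `d` with a nonzero numerator has degree `-w_B` here, but the component is
  -- zero.
  · by_cases hB : j < weight B.1
    · have h0 : (fun x : (U ⊓ ProjectiveSpectrum.basicOpen (baseGrading k n) f : Opens _) =>
          (Localization.mk (c B) ⟨d.1, hd x⟩ : Loc (baseGrading k n) x.1)) = 0 :=
        funext fun x => by rw [hc0 B hB, Localization.mk_zero]; rfl
      exact h0 ▸ lfd_zero _ _ _
    · exact TopCat.PrelocalPredicate.sheafifyOf ⟨j - weight B.1, j, ⟨c B, hc B⟩, d, by omega, hd,
        fun x => rfl⟩
  · obtain ⟨hd', h'⟩ := h y' (hb ⟨y', hfW y' hy'.2⟩)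
    refine h'.trans ?_
    exact ((congrArg HomogeneousLocalization.val (hr ⟨y', hfW y' hy'.2⟩)).trans
      (HomogeneousLocalization.val_mk _)).symm

lemma boxSectionsMap_bijective : Function.Bijective (boxSectionsMap T k n U) := by
  refine ⟨fun s s' h => boxValue_injective ?_, fun t => ?_⟩
  · rw [← valueOn_boxSectionsMap, h, valueOn_boxSectionsMap]
  rcases T.boxes.eq_empty_or_nonempty with hT | hT
  -- With no boxes, the basis expansion of `1` is an empty sum, so `S / J = 0`.
  · have : IsEmpty (ProjectiveSpectrum (diagramGrading T k n)) := by
      refine ⟨fun y => (Ideal.ne_top_iff_one _).mp y.isPrime.ne_top ?_⟩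
      have h := toCoordinateRing_eq_sum T k n 1
      have : IsEmpty T.boxes := ⟨fun B => absurd B.2 (by simp [hT])⟩
      rw [Finset.univ_eq_empty, Finset.sum_empty, map_one] at h
      exact h ▸ zero_mem _
    exact ⟨0, boxSectionsMap_eq_iff.mpr fun y => (this.false y.1).elim⟩
  · choose V hxV i s hs h using exists_local_boxSection hT t
    -- Two local lifts have the same image at a point of `Y` over `z`, so injectivity on the fibre
    -- makes them equal at `z`; the diagonal family `x ↦ s x x` is then locally a section.
    have h' : ∀ (x : U) (z : V x), s ⟨z.1, (i x).le z.2⟩ ⟨z.1, hxV ⟨z.1, (i x).le z.2⟩⟩ = s x z := by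
      rintro x ⟨z, hz⟩
      obtain ⟨y, rfl⟩ := projectPoint_surjective hT z
      exact fibreHom_injective y ((h _ y (hxV _)).trans (h x y hz).symm)
    refine ⟨⟨fun x => s x ⟨x.1, hxV x⟩, (boxPredicate (baseGrading k n) T).locality _ fun x =>
      ⟨V x, hxV x, i x, ?_⟩⟩, boxSectionsMap_eq_iff.mpr fun y => h _ y.1 (hxV _)⟩
    exact (congrArg (boxPredicate (baseGrading k n) T).pred (funext (h' x))).mpr (hs x)

end MonomialScheme

/-! ### The isomorphism of sheaves of algebras -/

namespace MonomialScheme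

namespace YoungDiag

lemma constant_mul_apply {m : ℕ} {T : YoungDiag m} {R : Type u} [CommRing R] (r : R)
    (v : T.BoxSum R) (B : T.boxes) : (constant T R r * v) B = r * v B := by
  obtain ⟨p, rfl⟩ := truncate_surjective v
  rw [constant_eq_truncate, ← truncate_mul]
  exact MvPolynomial.coeff_C_mul _ _ _

end YoungDiag

section Box

variable {A σ : Type u} [CommRing A] [SetLike σ A] [AddSubgroupClass σ A] (𝒜 : ℕ → σ) [GradedRing 𝒜]
  {m : ℕ} (T : YoungDiag m) (B : T.boxes) (U : Opens (ProjectiveSpectrum.top 𝒜))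

lemma boxSections_ext {s t : boxSections 𝒜 T U}
    (h : ∀ B, boxComponent 𝒜 T B U s = boxComponent 𝒜 T B U t) : s = t :=
  Subtype.ext (funext fun x => funext fun B => congrFun (congrArg Subtype.val (h B)) x)

lemma boxComponent_boxSingle (s : twistSections 𝒜 (-(weight B.1 : ℤ)) U) :
    boxComponent 𝒜 T B U (boxSingle 𝒜 T B U s) = s :=
  Subtype.ext (funext fun _ => if_pos rfl)

lemma boxComponent_boxSingle_of_ne {B C : T.boxes} (h : C ≠ B)
    (s : twistSections 𝒜 (-(weight B.1 : ℤ)) U) :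
    boxComponent 𝒜 T C U (boxSingle 𝒜 T B U s) = 0 :=
  Subtype.ext (funext fun _ => if_neg h)

lemma boxComponent_boxConstant_mul (r : Γ(Proj 𝒜, U)) (s : boxSections 𝒜 T U) :
    boxComponent 𝒜 T B U (boxConstant 𝒜 T U r * s) = r • boxComponent 𝒜 T B U s :=
  Subtype.ext (funext fun _ => YoungDiag.constant_mul_apply _ _ B)

lemma boxComponent_add (s t : boxSections 𝒜 T U) :
    boxComponent 𝒜 T B U (s + t) = boxComponent 𝒜 T B U s + boxComponent 𝒜 T B U t := rfl

/-- The coefficient of `e_B`, as a homomorphism of groups. -/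
noncomputable def boxComponentHom : boxSections 𝒜 T U →+ twistSections 𝒜 (-(weight B.1 : ℤ)) U where
  toFun := boxComponent 𝒜 T B U
  map_zero' := rfl
  map_add' := boxComponent_add 𝒜 T B U

/-- The inclusion of a summand, as a homomorphism of groups. -/
noncomputable def boxSingleHom : twistSections 𝒜 (-(weight B.1 : ℤ)) U →+ boxSections 𝒜 T U :=
  AddMonoidHom.mk' (boxSingle 𝒜 T B U) fun s t => boxSections_ext 𝒜 T U fun C => by
    rw [boxComponent_add]
    by_cases h : C = B
    · subst h
      simp only [boxComponent_boxSingle]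
    · simp only [boxComponent_boxSingle_of_ne 𝒜 T U h, add_zero]

lemma boxSingle_smul (r : Γ(Proj 𝒜, U)) (s : twistSections 𝒜 (-(weight B.1 : ℤ)) U) :
    boxSingle 𝒜 T B U (r • s) = boxConstant 𝒜 T U r * boxSingle 𝒜 T B U s :=
  boxSections_ext 𝒜 T U fun C => by
    rw [boxComponent_boxConstant_mul]
    by_cases h : C = B
    · subst h
      simp only [boxComponent_boxSingle]
    · simp only [boxComponent_boxSingle_of_ne 𝒜 T U h, smul_zero]

lemma sum_boxSingle (s : boxSections 𝒜 T U) :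
    ∑ B, boxSingle 𝒜 T B U (boxComponent 𝒜 T B U s) = s :=
  boxSections_ext 𝒜 T U fun C => by
    refine (map_sum (boxComponentHom 𝒜 T C U) _ _).trans ?_
    rw [Finset.sum_eq_single C]
    · exact boxComponent_boxSingle 𝒜 T C U _
    · exact fun B _ h => boxComponent_boxSingle_of_ne 𝒜 T U h.symm _
    · simp

end Box

variable {m : ℕ} (T : YoungDiag m) (k : Type u) [Field k] (n : ℕ)

/-- The sections of `⨁_B 𝒪(-w_B) e_B` are those of the structure sheaf of the multiple scheme. -/
noncomputable def boxSectionsEquiv (U : (projectiveSpace k n).Opens) :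
    boxSections (baseGrading k n) T U ≃+* Γ(multipleScheme T k n, projection T k n ⁻¹ᵁ U) :=
  RingEquiv.ofBijective (boxSectionsMap T k n U) boxSectionsMap_bijective

lemma fibreHom_constant (y : ProjectiveSpectrum (diagramGrading T k n))
    (r : Loc (baseGrading k n) (projectPoint T k n y)) :
    fibreHom T k n y (YoungDiag.constant T _ r) =
      locMap (coordinateMap T k n) (coordinateMap_irrelevant T k n) y r :=
  YoungDiag.boxSumLift_constant _ _ _ _

/-- Compatibility with the structure maps, seen on values: both sides are the image of `r` under
`locMap`, since `x^0 = 1`. -/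
lemma boxSectionsMap_boxConstant (U : (projectiveSpace k n).Opens)
    (r : Γ(projectiveSpace k n, U)) :
    boxSectionsMap T k n U (boxConstant (baseGrading k n) T U r) = (projection T k n).app U r :=
  boxSectionsMap_eq_iff.mpr fun y =>
    (fibreHom_constant T k n y.1 _).trans
      (val_fiberMap (coordinateMap T k n) (coordinateMap_irrelevant T k n) y.1 _).symm

lemma boxSectionsMap_restrict {U V : (projectiveSpace k n).Opens} (i : V ⟶ U)
    (s : boxSections (baseGrading k n) T U) :
    boxSectionsMap T k n V ((boxPresheaf (baseGrading k n) T).map i.op s) =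
      (multipleScheme T k n).presheaf.map ((Opens.map (projection T k n).base).map i).op
        (boxSectionsMap T k n U s) :=
  boxSectionsMap_eq_iff.mpr fun y =>
    (congrFun (valueOn_boxSectionsMap T k n U s) ⟨y.1, i.le y.2⟩).symm

/-- The isomorphism of presheaves of rings from `⨁_B 𝒪(-w_B) e_B` to the push-forward of the
structure sheaf of the multiple scheme. -/
noncomputable def boxPresheafIso :
    boxPresheaf (baseGrading k n) T ≅
      (pushforwardAlgebra (projection T k n)).right.obj :=
  NatIso.ofComponents (fun U => (boxSectionsEquiv T k n U.unop).toCommRingCatIso) fun i => by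
    ext s
    exact boxSectionsMap_restrict T k n i.unop s

/-- The isomorphism of sheaves of algebras from `⨁_B 𝒪(-w_B) e_B` to the push-forward of the
structure sheaf of the multiple scheme. -/
noncomputable def boxAlgebraIso :
    boxAlgebra (baseGrading k n) T ≅ pushforwardAlgebra (projection T k n) :=
  Under.isoMk
    { hom := ⟨(boxPresheafIso T k n).hom⟩
      inv := ⟨(boxPresheafIso T k n).inv⟩
      hom_inv_id := ObjectProperty.hom_ext _ (boxPresheafIso T k n).hom_inv_id
      inv_hom_id := ObjectProperty.hom_ext _ (boxPresheafIso T k n).inv_hom_id } (by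
    refine ObjectProperty.hom_ext _ ?_
    ext U r
    exact boxSectionsMap_boxConstant T k n U.unop r)

end MonomialScheme

/-! ### The push-forward as a biproduct of line bundles -/

namespace MonomialScheme

/-- A morphism of sheaves of modules from a natural family of linear maps on sections. -/
noncomputable def modulesHomMk {X : Scheme.{u}} {M N : X.Modules}
    (f : ∀ U : X.Opens, Γ(M, U) →+ Γ(N, U))
    (hres : ∀ (U V : X.Opens) (i : V ⟶ U) (x : Γ(M, U)),
      f V (M.presheaf.map i.op x) = N.presheaf.map i.op (f U x))
    (hsmul : ∀ (U : X.Opens) (r : Γ(X, U)) (x : Γ(M, U)), f U (r • x) = r • f U x) : M ⟶ N where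
  val := PresheafOfModules.homMk
    { app U := AddCommGrpCat.ofHom (f U.unop)
      naturality := fun U V i => by
        ext x
        exact hres U.unop V.unop i.unop x }
    (fun U r x => hsmul U.unop r x)

/-- The sections of `f_* 𝒪_Y` are those of `𝒪_Y`. -/
noncomputable def pushforwardSections {X Y : Scheme.{u}} (f : Y ⟶ X) (U : X.Opens) :
    Γ(Y, f ⁻¹ᵁ U) ≃+ Γ(pushforwardModule f, U) := AddEquiv.refl _

variable {A σ : Type u} [CommRing A] [SetLike σ A] [AddSubgroupClass σ A] (𝒜 : ℕ → σ) [GradedRing 𝒜]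

/-- Multiplication of a section of `𝒪(d)` by a function. -/
def twistSMul (d : ℤ) (U : Opens (ProjectiveSpectrum.top 𝒜)) (r : Γ(Proj 𝒜, U))
    (s : twistSections 𝒜 d U) : twistSections 𝒜 d U := r • s

/-- The sections of the Serre twist. -/
noncomputable def serreTwistSections (d : ℤ) (U : (Proj 𝒜).Opens) :
    twistSections 𝒜 d U ≃+ Γ(serreTwist 𝒜 d, U) := AddEquiv.refl _

variable {m : ℕ} (T : YoungDiag m)

lemma boxSingle_restrict (B : T.boxes) {U V : Opens (ProjectiveSpectrum.top 𝒜)} (i : V ⟶ U)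
    (s : twistSections 𝒜 (-(weight B.1 : ℤ)) U) :
    boxSingle 𝒜 T B V (twistRestrict 𝒜 _ i s) =
      (boxPresheaf 𝒜 T).map i.op (boxSingle 𝒜 T B U s) := rfl

lemma boxComponent_restrict (B : T.boxes) {U V : Opens (ProjectiveSpectrum.top 𝒜)} (i : V ⟶ U)
    (s : boxSections 𝒜 T U) :
    boxComponent 𝒜 T B V ((boxPresheaf 𝒜 T).map i.op s) =
      twistRestrict 𝒜 _ i (boxComponent 𝒜 T B U s) := rfl

variable (k : Type u) [Field k] (n : ℕ)

lemma boxSectionsMap_boxSingle_smul (B : T.boxes) (U : (projectiveSpace k n).Opens)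
    (r : Γ(projectiveSpace k n, U)) (s : twistSections (baseGrading k n) (-(weight B.1 : ℤ)) U) :
    boxSectionsMap T k n U (boxSingle (baseGrading k n) T B U (twistSMul _ _ U r s)) =
      (projection T k n).app U r * boxSectionsMap T k n U (boxSingle (baseGrading k n) T B U s) := by
  rw [← boxSectionsMap_boxConstant, ← map_mul]
  exact congrArg (boxSectionsMap T k n U) (boxSingle_smul (baseGrading k n) T B U r s)

lemma boxSectionsMap_boxSingle_restrict (B : T.boxes) {U V : (projectiveSpace k n).Opens}
    (i : V ⟶ U) (s : twistSections (baseGrading k n) (-(weight B.1 : ℤ)) U) :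
    boxSectionsMap T k n V (boxSingle (baseGrading k n) T B V (twistRestrict _ _ i s)) =
      (multipleScheme T k n).presheaf.map ((Opens.map (projection T k n).base).map i).op
        (boxSectionsMap T k n U (boxSingle (baseGrading k n) T B U s)) :=
  (congrArg (boxSectionsMap T k n V) (boxSingle_restrict (baseGrading k n) T B i s)).trans
    (boxSectionsMap_restrict T k n i (boxSingle (baseGrading k n) T B U s))

/-- The inclusion `s ↦ s x^B` of a summand. -/
noncomputable def lineBundleInclusion (B : T.boxes) :
    lineBundle k n (-(weight B.1 : ℤ)) ⟶ pushforwardModule (projection T k n) :=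
  modulesHomMk
    (fun U => (pushforwardSections (projection T k n) U).toAddMonoidHom.comp
      ((boxSectionsMap T k n U).toAddMonoidHom.comp
        ((boxSingleHom (baseGrading k n) T B U).comp
          (serreTwistSections (baseGrading k n) _ U).symm.toAddMonoidHom)))
    (fun _ V i s => congrArg (pushforwardSections (projection T k n) V)
      (boxSectionsMap_boxSingle_restrict T k n B i s))
    (fun U r s => congrArg (pushforwardSections (projection T k n) U)
      (boxSectionsMap_boxSingle_smul T k n B U r s))

lemma boxSectionsEquiv_symm_mul (U : (projectiveSpace k n).Opens) (r : Γ(projectiveSpace k n, U))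
    (t : Γ(multipleScheme T k n, projection T k n ⁻¹ᵁ U)) :
    (boxSectionsEquiv T k n U).symm ((projection T k n).app U r * t) =
      boxConstant (baseGrading k n) T U r * (boxSectionsEquiv T k n U).symm t := by
  refine (boxSectionsEquiv T k n U).symm_apply_eq.mpr ?_
  refine Eq.trans ?_ (map_mul (boxSectionsEquiv T k n U) _ _).symm
  exact congrArg₂ (· * ·) (boxSectionsMap_boxConstant T k n U r).symm
    ((boxSectionsEquiv T k n U).apply_symm_apply t).symm

lemma boxSectionsEquiv_symm_restrict {U V : (projectiveSpace k n).Opens} (i : V ⟶ U)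
    (t : Γ(multipleScheme T k n, projection T k n ⁻¹ᵁ U)) :
    (boxSectionsEquiv T k n V).symm
        ((multipleScheme T k n).presheaf.map ((Opens.map (projection T k n).base).map i).op t) =
      (boxPresheaf (baseGrading k n) T).map i.op ((boxSectionsEquiv T k n U).symm t) := by
  refine (boxSectionsEquiv T k n V).symm_apply_eq.mpr ?_
  refine Eq.trans ?_ (boxSectionsMap_restrict T k n i ((boxSectionsEquiv T k n U).symm t)).symm
  exact congrArg _ ((boxSectionsEquiv T k n U).apply_symm_apply t).symm

/-- The projection onto a summand. -/
noncomputable def lineBundleProjection (B : T.boxes) :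
    pushforwardModule (projection T k n) ⟶ lineBundle k n (-(weight B.1 : ℤ)) :=
  modulesHomMk
    (fun U => (serreTwistSections (baseGrading k n) _ U).toAddMonoidHom.comp
      ((boxComponentHom (baseGrading k n) T B U).comp
        ((boxSectionsEquiv T k n U).symm.toAddEquiv.toAddMonoidHom.comp
          (pushforwardSections (projection T k n) U).symm.toAddMonoidHom)))
    (fun _ V i t => congrArg (serreTwistSections (baseGrading k n) _ V)
      ((congrArg (boxComponent (baseGrading k n) T B V)
        (boxSectionsEquiv_symm_restrict T k n i t)).trans
        (boxComponent_restrict (baseGrading k n) T B i _)))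
    (fun U r t => congrArg (serreTwistSections (baseGrading k n) _ U)
      ((congrArg (boxComponent (baseGrading k n) T B U)
        (boxSectionsEquiv_symm_mul T k n U r t)).trans
        (boxComponent_boxConstant_mul (baseGrading k n) T B U r _)))

lemma lineBundleProjection_app (B : T.boxes) (U : (projectiveSpace k n).Opens)
    (s : boxSections (baseGrading k n) T U) :
    (lineBundleProjection T k n B).app U
        (pushforwardSections (projection T k n) U (boxSectionsMap T k n U s)) =
      serreTwistSections (baseGrading k n) _ U (boxComponent (baseGrading k n) T B U s) :=
  congrArg (fun s => serreTwistSections (baseGrading k n) _ U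
    (boxComponent (baseGrading k n) T B U s)) ((boxSectionsEquiv T k n U).symm_apply_apply s)

lemma lineBundleInclusion_projection (B : T.boxes) :
    lineBundleInclusion T k n B ≫ lineBundleProjection T k n B = 𝟙 _ := by
  ext U s
  exact (lineBundleProjection_app T k n B U (boxSingle (baseGrading k n) T B U s)).trans
    (congrArg (serreTwistSections (baseGrading k n) _ U)
      (boxComponent_boxSingle (baseGrading k n) T B U s))

lemma lineBundleInclusion_projection_of_ne {B C : T.boxes} (h : C ≠ B) :
    lineBundleInclusion T k n B ≫ lineBundleProjection T k n C = 0 := by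
  ext U s
  exact (lineBundleProjection_app T k n C U (boxSingle (baseGrading k n) T B U s)).trans
    (congrArg (serreTwistSections (baseGrading k n) _ U)
      (boxComponent_boxSingle_of_ne (baseGrading k n) T U h s))

lemma modules_sum_app {X : Scheme.{u}} {M N : X.Modules} {ι : Type*} (S : Finset ι)
    (f : ι → (M ⟶ N)) (U : X.Opens) (x : Γ(M, U)) :
    (∑ i ∈ S, f i).app U x = ∑ i ∈ S, (f i).app U x :=
  map_sum (AddMonoidHom.mk' (fun g : M ⟶ N => g.app U x) fun _ _ => rfl) f S

/-- This is `s = ∑ s_B e_B`, transported along the bijection on sections. With the orthogonality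
relations it makes the bicone a bilimit. -/
lemma sum_lineBundleProjection_inclusion :
    ∑ B, lineBundleProjection T k n B ≫ lineBundleInclusion T k n B =
      𝟙 (pushforwardModule (projection T k n)) := by
  ext U t
  obtain ⟨t, rfl⟩ := (pushforwardSections (projection T k n) U).surjective t
  obtain ⟨s, rfl⟩ := (boxSectionsEquiv T k n U).surjective t
  refine (modules_sum_app _ _ U _).trans ?_
  have h (B : T.boxes) : (lineBundleProjection T k n B ≫ lineBundleInclusion T k n B).app U
      (pushforwardSections (projection T k n) U (boxSectionsMap T k n U s)) =
      pushforwardSections (projection T k n) U (boxSectionsMap T k n U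
        (boxSingle (baseGrading k n) T B U (boxComponent (baseGrading k n) T B U s))) :=
    congrArg ((lineBundleInclusion T k n B).app U) (lineBundleProjection_app T k n B U s)
  refine (Finset.sum_congr rfl fun B _ => h B).trans ?_
  refine ((map_sum (pushforwardSections (projection T k n) U) _ _).symm.trans ?_)
  refine congrArg (pushforwardSections (projection T k n) U) ?_
  refine (map_sum (boxSectionsMap T k n U) _ _).symm.trans ?_
  exact congrArg (boxSectionsMap T k n U) (sum_boxSingle (baseGrading k n) T U s)

/-- The push-forward of the structure sheaf of the multiple scheme as a sum of line bundles. -/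
noncomputable def pushforwardBicone :
    Bicone fun B : T.boxes => lineBundle k n (-(weight B.1 : ℤ)) where
  pt := pushforwardModule (projection T k n)
  π := lineBundleProjection T k n
  ι := lineBundleInclusion T k n
  ι_π B C := by
    by_cases h : B = C
    · subst h
      rw [dif_pos rfl, eqToHom_refl, lineBundleInclusion_projection]
    · rw [dif_neg h, lineBundleInclusion_projection_of_ne T k n (Ne.symm h)]

/-- The push-forward of the structure sheaf is the direct sum of the line bundles. -/
noncomputable def pushforwardBiconeIsBilimit : (pushforwardBicone T k n).IsBilimit :=
  isBilimitOfTotal _ (sum_lineBundleProjection_inclusion T k n)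

lemma boxValue_boxSingle (B : T.boxes) (U : (projectiveSpace k n).Opens)
    (s : twistSections (baseGrading k n) (-(weight B.1 : ℤ)) U)
    (y : (projection T k n ⁻¹ᵁ U : (multipleScheme T k n).Opens)) :
    boxValue T k n U (boxSingle (baseGrading k n) T B U s) y = timesMonomial T k n B.1 U s y := by
  have h := congrFun (boxValue_eq_sum T k n U (boxSingle (baseGrading k n) T B U s)) y
  refine h.trans ((Finset.sum_eq_single B (fun C _ hC => ?_) (by simp)).trans ?_)
  · refine (congrArg (fun s => timesMonomial T k n C.1 U s y)
      (boxComponent_boxSingle_of_ne (baseGrading k n) T U hC s)).trans ?_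
    exact (congrArg (· * _) (map_zero (locMap (coordinateMap T k n)
      (coordinateMap_irrelevant T k n) y.1))).trans (zero_mul _)
  · exact congrArg (fun s => timesMonomial T k n B.1 U s y)
      (boxComponent_boxSingle (baseGrading k n) T B U s)

end MonomialScheme

theorem theorem3p3 (k : Type u) [Field k] (n m : ℕ) (T : YoungDiag m) :
    ∃ (φ : (⨁ fun B : T.boxes => lineBundle k n (-(weight B.1 : ℤ))) ≅
          pushforwardModule (projection T k n))
      (ψ : boxAlgebra (baseGrading k n) T ≅ pushforwardAlgebra (projection T k n)),
      ∀ (B : T.boxes) (U : (projectiveSpace k n).Opens)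
        (s : Γ(lineBundle k n (-(weight B.1 : ℤ)), U)),
        ((ψ.hom.right.hom.app (op U)).hom (boxSingle (baseGrading k n) T B U s) =
          φ.hom.app U ((biproduct.ι (fun B : T.boxes =>
            lineBundle k n (-(weight B.1 : ℤ))) B).app U s)) ∧
        ∀ y, valueOn T k n U
            ((ψ.hom.right.hom.app (op U)).hom (boxSingle (baseGrading k n) T B U s)) y =
          timesMonomial T k n B.1 U s y := by
  refine ⟨(biproduct.uniqueUpToIso _ (pushforwardBiconeIsBilimit T k n)).symm,
    boxAlgebraIso T k n, fun B U s => ⟨?_, fun y => ?_⟩⟩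
  -- The module isomorphism restricts on each summand to `lineBundleInclusion`, which was built from
  -- the same map on sections as the algebra isomorphism; so the two agree.
  · have h : biproduct.ι (fun B : T.boxes => lineBundle k n (-(weight B.1 : ℤ))) B ≫
        (biproduct.uniqueUpToIso _ (pushforwardBiconeIsBilimit T k n)).symm.hom =
        lineBundleInclusion T k n B := biproduct.ι_desc _ _
    exact (congrArg (fun g => Scheme.Modules.Hom.app g U s) h).symm
  · exact (congrFun (valueOn_boxSectionsMap T k n U (boxSingle (baseGrading k n) T B U s)) y).trans
      (boxValue_boxSingle T k n B U s y)
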